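/- Let $\mathbb{K}$ be $\mathbb{N}$ or $\mathbb{Q}$. A subset of $\mathbb{K}^d$ is *$\mathbb{K}$-definable* if it is definable over $\mathbb{K}$ by a first-order formula using $+$, the scalar multiplications $x\mapsto ex$ ($e\in\mathbb{K}$), the order $<$ and constants from $\mathbb{K}$. A *$\mathbb{K}$-affine Parikh automaton* ($\mathbb{K}$-APA) of dimension $d\ge 1$ over a finite alphabet $\Sigma$ is a triple $(A,U,C)$, where $A=(Q,\Sigma,\delta,q_0,F)$ is a finite automaton with $\delta\subseteq Q\times\Sigma\times Q$, $U$ assigns to every transition $t\in\delta$ an affine function $U(t)\colon x\mapsto M_t x+v_t$ on $\mathbb{K}^d$ ($M_t\in\mathbb{K}^{d\times d}$, $v_t\in\mathbb{K}^d$), and $C\subseteq\mathbb{K}^d$ is $\mathbb{K}$-definable. A word is in its language $L(A,U,C)$ iff it is the label of an accepting path $t_1\cdots t_n$ of $A$ (a path from $q_0$ to a state of $F$; the empty path is accepting iff $q_0\in F$) such that $U(t_n)(\cdots U(t_1)(0)\cdots)\in C$. It is *deterministic* ($\mathbb{K}$-DetAPA) if for every $p\in Q$ and $a\in\Sigma$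 there is at most one $q$ with $(p,a,q)\in\delta$. Let $\mathcal{L}_{\mathbb{K}\text{-APA}}$ and $\mathcal{L}_{\mathbb{K}\text{-DetAPA}}$ be the classes of languages recognised by $\mathbb{K}$-APA and $\mathbb{K}$-DetAPA. As inputs and outputs of algorithms, automata are given by the finite list of their transitions with the (integer or rational) entries of $M_t$, $v_t$ and by a first-order formula defining $C$. Then: 1. There is an algorithm that, given a finite alphabet $\Sigma$ and a one-tape deterministic Turing machine $M$ with input alphabet $\Sigma$, computes a finite alphabet $\Gamma$, two $\mathbb{Q}$-DetAPA over $\Gamma$ with languages $L_1,L_2\subseteq\Gamma^*$, and a morphism $h\colon\Gamma^*\to\Sigma^*$ (which may erase letters), such that the language recognised by $M$ is $h(L_1\cap L_2)$. In particular every Turing-recognisable language is of the form $h(L_1\cap L_2)$ with $L_1,L_2\in\mathcal{L}_{\mathbb{Q}\text{-DetAPA}}$. 2. For $\mathbb{K}=\mathbb{N}$ and for $\mathbb{K}=\mathbb{Q}$, the emptiness problem for $\mathbb{K}$-DetAPA is undecidable: no algorithm decides, given an alphabet and a $\mathbb{K}$-DetAPA over it, whether its language is empty. 3. For $\mathbb{K}=\mathbb{N}$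 and for $\mathbb{K}=\mathbb{Q}$, neither $\mathcal{L}_{\mathbb{K}\text{-APA}}$ nor $\mathcal{L}_{\mathbb{K}\text{-DetAPA}}$ is closed under morphisms. 4. For $\mathbb{K}=\mathbb{N}$ and for $\mathbb{K}=\mathbb{Q}$, it is undecidable, given an alphabet and a $\mathbb{K}$-APA over it, whether its language is finite. -/

import Mathlib

/-! ### Definable sets -/

namespace APA

open FirstOrder

/-- Function symbols: binary `+` and, for every `e : K`, the scalar multiplication `x ↦ e * x`. -/
inductive OrdFunc (K : Type) : ℕ → Type
  | add : OrdFunc K 2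
  | scale (e : K) : OrdFunc K 1

/-- Relation symbols: the order `<` (equality is a logical symbol). -/
inductive OrdRel : ℕ → Type
  | lt : OrdRel 2

/-- The first-order language with `+`, scalar multiplications, and `<`. -/
def ordLang (K : Type) : Language := ⟨OrdFunc K, OrdRel⟩

instance ordLangStructure (K : Type) [CommSemiring K] [LinearOrder K] :
    (ordLang K).Structure K where
  funMap := fun f x => match f with
    | OrdFunc.add => x 0 + x 1
    | OrdFunc.scale e => e * x 0
  RelMap := fun r x => match r with
    | OrdRel.lt => x 0 < x 1

/-- `K`-definable subsets of `K ^ d`: first-order definable from `+`, scalar multiplication, `<`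
and constants from `K`. For `K = ℕ` these are the Presburger definable sets, for `K = ℚ` the
semialgebraic sets defined by affine functions. -/
def IsDefinable (K : Type) [CommSemiring K] [LinearOrder K] {d : ℕ} (C : Set (Fin d → K)) : Prop :=
  (Set.univ : Set K).Definable (ordLang K) C

/-! ### Automata and affine Parikh automata -/

/-- Finite automata over `σ`, without `ε`-transitions and with one initial state. -/
structure FinAutomaton (σ : Type) where
  Q : Type
  finite : Finite Q
  δ : Set (Q × σ × Q)
  q₀ : Q
  F : Set Q

namespace FinAutomaton

variable {σ : Type}

/-- `A.IsPath p π q`: the word `π` over the transitions is a path from `p` to `q`. -/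
def IsPath (A : FinAutomaton σ) : A.Q → List (A.Q × σ × A.Q) → A.Q → Prop
  | p, [], q => p = q
  | p, t :: π, q => t ∈ A.δ ∧ t.1 = p ∧ A.IsPath t.2.2 π q

/-- The accepting paths (the empty path is accepting iff the initial state is final). -/
def Run (A : FinAutomaton σ) : Set (List (A.Q × σ × A.Q)) :=
  {π | ∃ q ∈ A.F, A.IsPath A.q₀ π q}

/-- The label of a path. -/
def label (A : FinAutomaton σ) (π : List (A.Q × σ × A.Q)) : List σ := π.map fun t => t.2.1

def IsDeterministic (A : FinAutomaton σ) : Prop :=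
  ∀ p a q q', (p, a, q) ∈ A.δ → (p, a, q') ∈ A.δ → q = q'

end FinAutomaton

/-- The affine function `x ↦ M x + v` on `K ^ d`. -/
structure Affine (K : Type) (d : ℕ) where
  M : Matrix (Fin d) (Fin d) K
  v : Fin d → K

def Affine.apply {K : Type} [CommSemiring K] {d : ℕ} (f : Affine K d) (x : Fin d → K) :
    Fin d → K :=
  f.M.mulVec x + f.v

/-- `K`-affine Parikh automata over the alphabet `σ`. Only the values of `U` on the transitions
of `A` matter. -/
structure AffineParikhAutomaton (K : Type) [CommSemiring K] [LinearOrder K] (σ : Type) where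
  A : FinAutomaton σ
  d : ℕ
  d_pos : 0 < d
  U : A.Q × σ × A.Q → Affine K d
  C : Set (Fin d → K)
  definable : IsDefinable K C

namespace AffineParikhAutomaton

variable {K : Type} [CommSemiring K] [LinearOrder K] {σ : Type}

/-- `U` extended to paths: the function of the first transition is applied first. -/
def pathMap (P : AffineParikhAutomaton K σ) (π : List (P.A.Q × σ × P.A.Q)) (x : Fin P.d → K) :
    Fin P.d → K :=
  π.foldl (fun y t => (P.U t).apply y) x

def language (P : AffineParikhAutomaton K σ) : Set (List σ) :=
  {w | ∃ π ∈ P.A.Run, P.pathMap π 0 ∈ P.C ∧ P.A.label π = w}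

def IsDeterministic (P : AffineParikhAutomaton K σ) : Prop := P.A.IsDeterministic

end AffineParikhAutomaton

/-- The languages of `K`-affine Parikh automata. -/
def IsAPALanguage (K : Type) [CommSemiring K] [LinearOrder K] {σ : Type} (L : Set (List σ)) :
    Prop :=
  ∃ P : AffineParikhAutomaton K σ, P.language = L

/-- The languages of deterministic `K`-affine Parikh automata. -/
def IsDetAPALanguage (K : Type) [CommSemiring K] [LinearOrder K] {σ : Type} (L : Set (List σ)) :
    Prop :=
  ∃ P : AffineParikhAutomaton K σ, P.IsDeterministic ∧ P.language = L

/-- The image of a language under the (possibly erasing) word morphism given by the images of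
the letters. -/
def morphImage {σ τ : Type} (h : σ → List τ) (L : Set (List σ)) : Set (List τ) :=
  (fun w => w.flatMap h) '' L

/-- Closure under morphisms of a class of languages over finite alphabets. -/
def ClosedUnderMorphisms (𝓛 : ∀ n : ℕ, Set (List (Fin n)) → Prop) : Prop :=
  ∀ (m n : ℕ) (h : Fin m → List (Fin n)) (L : Set (List (Fin m))), 𝓛 m L → 𝓛 n (morphImage h L)

/-! ### Finite presentations of affine Parikh automata

The coefficients are written in a type `R` of numerals, with values in `K` given by a map
`val : R → K`. -/

/-- Terms in the variables `var 0, var 1, …`. -/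
inductive Tm (R : Type) : Type
  | var (i : ℕ) : Tm R
  | const (r : R) : Tm R
  | add (t u : Tm R) : Tm R
  | scale (r : R) (t : Tm R) : Tm R

/-- First-order formulas. In `ex φ`, the variable `0` of `φ` is bound and the variable `i + 1`
of `φ` is the variable `i` of `ex φ`. -/
inductive Fm (R : Type) : Type
  | lt (t u : Tm R) : Fm R
  | eq (t u : Tm R) : Fm R
  | not (φ : Fm R) : Fm R
  | and (φ ψ : Fm R) : Fm R
  | ex (φ : Fm R) : Fm R

section Semantics

variable {R K : Type} [CommSemiring K] [LinearOrder K] (val : R → K)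

def Tm.eval : Tm R → (ℕ → K) → K
  | .var i, x => x i
  | .const r, _ => val r
  | .add t u, x => t.eval x + u.eval x
  | .scale r t, x => val r * t.eval x

def Fm.Holds : Fm R → (ℕ → K) → Prop
  | .lt t u, x => t.eval val x < u.eval val x
  | .eq t u, x => t.eval val x = u.eval val x
  | .not φ, x => ¬ φ.Holds x
  | .and φ ψ, x => φ.Holds x ∧ ψ.Holds x
  | .ex φ, x => ∃ a : K, φ.Holds (fun i => Nat.casesOn i a x)

/-- The vector `x` as an assignment of the variables; variables outside the range are `0`. -/
def assign {d : ℕ} (x : Fin d → K) (i : ℕ) : K := if h : i < d then x ⟨i, h⟩ else 0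

/-- The subset of `K ^ d` defined by a formula; coordinate `i` is the variable `i`. -/
def Fm.toSet (φ : Fm R) (d : ℕ) : Set (Fin d → K) := {x | φ.Holds val (assign x)}

theorem Tm.exists_term (t : Tm R) (d : ℕ) :
    ∃ s : ((ordLang K)[[(Set.univ : Set K)]]).Term (Fin d),
      ∀ x : Fin d → K, s.realize x = t.eval val (assign x) := by
  induction t with
  | var i =>
    by_cases h : i < d
    · exact ⟨Language.Term.var ⟨i, h⟩, fun x => by simp [Tm.eval, assign, h]⟩
    · exact ⟨((ordLang K).con (⟨0, trivial⟩ : (Set.univ : Set K))).term,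
        fun x => by simp [Tm.eval, assign, h]⟩
  | const r =>
    exact ⟨((ordLang K).con (⟨val r, trivial⟩ : (Set.univ : Set K))).term,
      fun x => by simp [Tm.eval]⟩
  | add t u iht ihu =>
    obtain ⟨s, hs⟩ := iht
    obtain ⟨s', hs'⟩ := ihu
    refine ⟨Language.Term.func (Sum.inl (OrdFunc.add : (ordLang K).Functions 2)) ![s, s'],
      fun x => ?_⟩
    simp only [Tm.eval, ← hs, ← hs']
    rfl
  | scale r t iht =>
    obtain ⟨s, hs⟩ := iht
    refine ⟨Language.Term.func (Sum.inl (OrdFunc.scale (val r) : (ordLang K).Functions 1)) ![s],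
      fun x => ?_⟩
    simp only [Tm.eval, ← hs]
    rfl

theorem Fm.isDefinable (φ : Fm R) : ∀ d : ℕ, IsDefinable K (φ.toSet val d) := by
  induction φ with
  | lt t u =>
    intro d
    obtain ⟨s, hs⟩ := t.exists_term val d
    obtain ⟨s', hs'⟩ := u.exists_term val d
    let r : ((ordLang K)[[(Set.univ : Set K)]]).Relations 2 :=
      Sum.inl (OrdRel.lt : (ordLang K).Relations 2)
    refine ⟨r.formula ![s, s'], ?_⟩
    ext x
    change t.eval val (assign x) < u.eval val (assign x) ↔ Language.Formula.Realize _ x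
    rw [← hs, ← hs']
    refine Iff.trans ?_ (Language.Formula.realize_rel (M := K) (R := r)).symm
    exact Iff.rfl
  | eq t u =>
    intro d
    obtain ⟨s, hs⟩ := t.exists_term val d
    obtain ⟨s', hs'⟩ := u.exists_term val d
    refine ⟨s.equal s', ?_⟩
    ext x
    change t.eval val (assign x) = u.eval val (assign x) ↔ Language.Formula.Realize _ x
    rw [← hs, ← hs', Language.Formula.realize_equal]
  | not φ ih => exact fun d => (ih d).compl
  | and φ ψ ih ih' => exact fun d => (ih d).inter (ih' d)
  | ex φ ih =>
    intro d
    have h := (ih (d + 1)).image_comp (Fin.succ : Fin d → Fin (d + 1))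
    refine (congrArg _ ?_).mp h
    have key : ∀ (a : K) (x : Fin d → K),
        assign (Fin.cons a x : Fin (d + 1) → K) = fun i => Nat.casesOn i a (assign x) := by
      intro a x
      funext i
      cases i with
      | zero => simp [assign]
      | succ i =>
        by_cases h : i < d
        · simp only [assign, dif_pos h, dif_pos (Nat.succ_lt_succ h)]
          exact Fin.cons_succ (α := fun _ => K) a x ⟨i, h⟩
        · simp [assign, h]
    ext x
    constructor
    · rintro ⟨g, hg, rfl⟩
      refine ⟨g 0, ?_⟩
      rw [← key]
      have : (Fin.cons (g 0) (g ∘ Fin.succ) : Fin (d + 1) → K) = g := Fin.cons_self_tail g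
      rw [this]
      exact hg
    · rintro ⟨a, ha⟩
      refine ⟨Fin.cons a x, ?_, ?_⟩
      · change Fm.Holds val φ (assign _)
        rw [key]
        exact ha
      · funext i
        simp

end Semantics

section Numbering

variable {R : Type} [Denumerable R]

open Encodable Denumerable

/-- Gödel numbering of terms. -/
def Tm.toNat : Tm R → ℕ
  | .var i => 4 * i
  | .const r => 4 * encode r + 1
  | .add t u => 4 * Nat.pair t.toNat u.toNat + 2
  | .scale r t => 4 * Nat.pair (encode r) t.toNat + 3

def Tm.decodeNat (n : ℕ) : Tm R :=
  if n % 4 = 0 then .var (n / 4)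
  else if n % 4 = 1 then .const (ofNat R (n / 4))
  else if n % 4 = 2 then
    .add (Tm.decodeNat (n / 4).unpair.1) (Tm.decodeNat (n / 4).unpair.2)
  else .scale (ofNat R (n / 4).unpair.1) (Tm.decodeNat (n / 4).unpair.2)
termination_by n
decreasing_by
  all_goals
    have h1 := Nat.unpair_left_le (n / 4)
    have h2 := Nat.unpair_right_le (n / 4)
    omega

theorem Tm.decodeNat_toNat (t : Tm R) : Tm.decodeNat t.toNat = t := by
  induction t with
  | var i => rw [Tm.toNat, Tm.decodeNat]; simp
  | const r =>
    have h1 : (4 * encode r + 1) / 4 = encode r := by omega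
    have h2 : (4 * encode r + 1) % 4 = 1 := by omega
    rw [Tm.toNat, Tm.decodeNat]; simp [h1, h2]
  | add t u iht ihu =>
    have h1 : (4 * Nat.pair t.toNat u.toNat + 2) / 4 = Nat.pair t.toNat u.toNat := by omega
    have h2 : (4 * Nat.pair t.toNat u.toNat + 2) % 4 = 2 := by omega
    rw [Tm.toNat, Tm.decodeNat]; simp [h1, h2, iht, ihu]
  | scale r t iht =>
    have h1 : (4 * Nat.pair (encode r) t.toNat + 3) / 4 = Nat.pair (encode r) t.toNat := by omega
    have h2 : (4 * Nat.pair (encode r) t.toNat + 3) % 4 = 3 := by omega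
    rw [Tm.toNat, Tm.decodeNat]; simp [h1, h2, iht]

theorem Tm.toNat_decodeNat (n : ℕ) : (Tm.decodeNat n : Tm R).toNat = n := by
  induction n using Nat.strong_induction_on with
  | _ n ih =>
    have h1 := Nat.unpair_left_le (n / 4)
    have h2 := Nat.unpair_right_le (n / 4)
    rw [Tm.decodeNat]
    split_ifs with h h' h''
    · simp only [Tm.toNat]; omega
    · simp only [Tm.toNat, encode_ofNat]; omega
    · simp only [Tm.toNat]
      rw [ih _ (by omega), ih _ (by omega), Nat.pair_unpair]; omega
    · simp only [Tm.toNat, encode_ofNat]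
      rw [ih _ (by omega), Nat.pair_unpair]; omega

instance : Denumerable (Tm R) :=
  Denumerable.mk' ⟨Tm.toNat, Tm.decodeNat, Tm.decodeNat_toNat, Tm.toNat_decodeNat⟩

/-- Gödel numbering of formulas. -/
def Fm.toNat : Fm R → ℕ
  | .lt t u => 5 * Nat.pair (encode t) (encode u)
  | .eq t u => 5 * Nat.pair (encode t) (encode u) + 1
  | .not φ => 5 * φ.toNat + 2
  | .and φ ψ => 5 * Nat.pair φ.toNat ψ.toNat + 3
  | .ex φ => 5 * φ.toNat + 4

def Fm.decodeNat (n : ℕ) : Fm R :=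
  if n % 5 = 0 then .lt (ofNat (Tm R) (n / 5).unpair.1) (ofNat (Tm R) (n / 5).unpair.2)
  else if n % 5 = 1 then .eq (ofNat (Tm R) (n / 5).unpair.1) (ofNat (Tm R) (n / 5).unpair.2)
  else if n % 5 = 2 then .not (Fm.decodeNat (n / 5))
  else if n % 5 = 3 then
    .and (Fm.decodeNat (n / 5).unpair.1) (Fm.decodeNat (n / 5).unpair.2)
  else .ex (Fm.decodeNat (n / 5))
termination_by n
decreasing_by
  all_goals
    have h1 := Nat.unpair_left_le (n / 5)
    have h2 := Nat.unpair_right_le (n / 5)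
    omega

theorem Fm.decodeNat_toNat (φ : Fm R) : Fm.decodeNat φ.toNat = φ := by
  induction φ with
  | lt t u => rw [Fm.toNat, Fm.decodeNat]; simp
  | eq t u =>
    have h1 : (5 * Nat.pair (encode t) (encode u) + 1) / 5 = Nat.pair (encode t) (encode u) := by
      omega
    have h2 : (5 * Nat.pair (encode t) (encode u) + 1) % 5 = 1 := by omega
    rw [Fm.toNat, Fm.decodeNat]; simp [h1, h2]
  | not φ ih =>
    have h1 : (5 * φ.toNat + 2) / 5 = φ.toNat := by omega
    have h2 : (5 * φ.toNat + 2) % 5 = 2 := by omega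
    rw [Fm.toNat, Fm.decodeNat]; simp [h1, h2, ih]
  | and φ ψ ih ih' =>
    have h1 : (5 * Nat.pair φ.toNat ψ.toNat + 3) / 5 = Nat.pair φ.toNat ψ.toNat := by omega
    have h2 : (5 * Nat.pair φ.toNat ψ.toNat + 3) % 5 = 3 := by omega
    rw [Fm.toNat, Fm.decodeNat]; simp [h1, h2, ih, ih']
  | ex φ ih =>
    have h1 : (5 * φ.toNat + 4) / 5 = φ.toNat := by omega
    have h2 : (5 * φ.toNat + 4) % 5 = 4 := by omega
    rw [Fm.toNat, Fm.decodeNat]; simp [h1, h2, ih]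

theorem Fm.toNat_decodeNat (n : ℕ) : (Fm.decodeNat n : Fm R).toNat = n := by
  induction n using Nat.strong_induction_on with
  | _ n ih =>
    have h1 := Nat.unpair_left_le (n / 5)
    have h2 := Nat.unpair_right_le (n / 5)
    rw [Fm.decodeNat]
    split_ifs
    · simp only [Fm.toNat, encode_ofNat, Nat.pair_unpair]; omega
    · simp only [Fm.toNat, encode_ofNat, Nat.pair_unpair]; omega
    · simp only [Fm.toNat]
      rw [ih _ (by omega)]; omega
    · simp only [Fm.toNat]
      rw [ih _ (by omega), ih _ (by omega), Nat.pair_unpair]; omega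
    · simp only [Fm.toNat]
      rw [ih _ (by omega)]; omega

instance : Denumerable (Fm R) :=
  Denumerable.mk' ⟨Fm.toNat, Fm.decodeNat, Fm.decodeNat_toNat, Fm.toNat_decodeNat⟩

end Numbering

/-- A finite presentation of an affine Parikh automaton over an alphabet `Fin k`: states are
`0, …, maxState`, the dimension is `predDim + 1`, and an entry `((p, a, q), rows, v)` of `trans`
is a transition from `p` to `q` reading `a`, with the affine function `x ↦ rows * x + v`. -/
structure Code (R : Type) where
  maxState : ℕ
  initial : ℕ
  final : List ℕ
  predDim : ℕ
  trans : List ((ℕ × ℕ × ℕ) × List (List R) × List R)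
  constraint : Fm R

/-- Codes as tuples. -/
def Code.equivProd (R : Type) :
    Code R ≃ ℕ × ℕ × List ℕ × ℕ × List ((ℕ × ℕ × ℕ) × List (List R) × List R) × Fm R where
  toFun c := (c.maxState, c.initial, c.final, c.predDim, c.trans, c.constraint)
  invFun x := ⟨x.1, x.2.1, x.2.2.1, x.2.2.2.1, x.2.2.2.2.1, x.2.2.2.2.2⟩
  left_inv _ := rfl
  right_inv _ := rfl

instance (R : Type) [Denumerable R] : Primcodable (Code R) :=
  Primcodable.ofEquiv _ (Code.equivProd R)

section Interpretation

variable {R K : Type} [CommSemiring K] [LinearOrder K] (val : R → K)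

/-- The affine function with the given rows and vector; missing entries are `0`, superfluous
ones are ignored. -/
def affineOfLists (d : ℕ) (rows : List (List R)) (v : List R) : Affine K d where
  M := fun i j => (((rows.getD i []).map val).getD j 0)
  v := fun i => (v.map val).getD i 0

/-- The affine Parikh automaton over `Fin k` presented by a code. Entries of `trans` with states
or letters out of range are ignored; among several entries for the same triple the first counts. -/
def Code.toAPA (c : Code R) (k : ℕ) : AffineParikhAutomaton K (Fin k) where
  A :=
    { Q := Fin (c.maxState + 1)
      finite := inferInstance
      δ := {t | (c.trans.lookup ((t.1 : ℕ), (t.2.1 : ℕ), (t.2.2 : ℕ))).isSome}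
      q₀ := Fin.ofNat (c.maxState + 1) c.initial
      F := {q | (q : ℕ) ∈ c.final} }
  d := c.predDim + 1
  d_pos := Nat.succ_pos _
  U := fun t =>
    let e := (c.trans.lookup ((t.1 : ℕ), (t.2.1 : ℕ), (t.2.2 : ℕ))).getD ([], [])
    affineOfLists val (c.predDim + 1) e.1 e.2
  C := c.constraint.toSet val (c.predDim + 1)
  definable := c.constraint.isDefinable val _

end Interpretation

/-- The automaton over `ℕ` presented by a code. -/
abbrev Code.natAPA (c : Code ℕ) (k : ℕ) : AffineParikhAutomaton ℕ (Fin k) := c.toAPA id k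

/-- The automaton over `ℚ` presented by a code; the numeral `(p, q)` stands for `p / (q + 1)`. -/
abbrev Code.ratAPA (c : Code (ℤ × ℕ)) (k : ℕ) : AffineParikhAutomaton ℚ (Fin k) :=
  c.toAPA (fun r => (r.1 : ℚ) / ((r.2 : ℚ) + 1)) k

/-- The morphism `(Fin m)* → (Fin k)*` presented by a list: the `i`-th entry is the image of the
letter `i` (numbers that are not letters are dropped). -/
def morphOfCode (H : List (List ℕ)) (m k : ℕ) (i : Fin m) : List (Fin k) :=
  (H.getD i []).filterMap fun j => if h : j < k then some ⟨j, h⟩ else none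

/-! ### Turing machines -/

/-- A deterministic one-tape Turing machine given by a finite table. States and tape symbols are
natural numbers, the initial state is `0` and the blank is `0`. An entry `((q, a), (q', s))` means:
in state `q` reading `a`, go to state `q'` and perform `s`, where `inl true` moves the head to the
right, `inl false` moves it to the left, and `inr b` writes `b`. The first entry for `(q, a)`
counts; if there is none, the machine halts. -/
structure TMachine where
  table : List ((ℕ × ℕ) × (ℕ × (Bool ⊕ ℕ)))
  accept : List ℕ

/-- Turing machines as tuples. -/
def TMachine.equivProd : TMachine ≃ List ((ℕ × ℕ) × (ℕ × (Bool ⊕ ℕ))) × List ℕ where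
  toFun M := (M.table, M.accept)
  invFun x := ⟨x.1, x.2⟩
  left_inv _ := rfl
  right_inv _ := rfl

instance : Primcodable TMachine := Primcodable.ofEquiv _ TMachine.equivProd

/-- The action described by the second part of a table entry. -/
def actionOf : Bool ⊕ ℕ → Turing.TM0.Stmt ℕ
  | .inl true => .move .right
  | .inl false => .move .left
  | .inr b => .write b

def TMachine.machine (M : TMachine) : Turing.TM0.Machine ℕ ℕ :=
  fun q a => (M.table.lookup (q, a)).map fun e => (e.1, actionOf e.2)

/-- The language over `Fin k` recognised by `M`: the words `w` such that `M`, started in its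
initial state on the first letter of `w` (the letter `i` is written as the tape symbol `i + 1`),
halts in an accepting state. -/
def TMachine.language (M : TMachine) (k : ℕ) : Set (List (Fin k)) :=
  {w | ∃ c : Turing.TM0.Cfg ℕ ℕ,
    Turing.TM0.Reaches M.machine (Turing.TM0.init (List.map (fun i : Fin k => i.val + 1) w)) c ∧
      Turing.TM0.step M.machine c = none ∧ c.q ∈ M.accept}

end APA

/-! The whole theorem rests on one fact. For every recursively enumerable relation `T e N` there is
a single deterministic automaton scheme, computable from `e` and the size `k` of the input alphabet,
whose language is mapped by an erasing morphism onto the words `u` with `T e N`, where `N` is the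
value of `u` in base `k + 1` (`exists_queueCode`).

A queue machine is a finite graph whose edges read and write words. A path from the initial to the
final state is accepted when everything it writes equals everything it reads. Writing and reading a
word are affine operations on its value in a base `B`, and words of nonzero digits are determined by
their values, so one equation between two registers checks acceptance. A third register computes a
number `n` along the path and a fourth holds the value `N` of the input; the constraint `n = 2 ^ e *
(2 * N + 1)` hands both `e` and `N` to the machine. The letters of the automaton are the moves
themselves, which makes it deterministic, together with the input letters, which loop in the initial
state; the morphism erases the moves.

Queue machines simulate Turing machines with the tape stored cyclically in the queue
(`accepts_tmTile_iff`). They first guess the binary digits of `n`, computing `n` at the same time.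
Hence they accept every recursively enumerable set of positive numbers (`exists_tiles`).

For the representation of Turing languages, `e` is the code of the pair of alphabet and machine, and
`N` ranges over the values of the recognised words; one automaton serves as both `L₁` and `L₂`. For
emptiness and finiteness, `T e N` says that program `e` halts, whatever `N` is: the image is then
all words or none. For nonclosure, some morphic image is the unary encoding of the halting set,
whereas a unary language of a fixed affine Parikh automaton is decidable: the finitely many
configurations reachable in `n` steps are listed and tested against the constraint. This test is
effective over `ℕ` because definable sets are semilinear, and over `ℚ` because membership depends
only on the signs of finitely many affine forms. -/

namespace APA

open Turing

/-! ### Queue systems -/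

/-- A move of a queue machine: it goes from `src` to `tgt`, removes `read` from the front of the
queue, appends `write` at its end, and updates a number by `n ↦ mul * n + add`. -/
structure Tile (S Δ : Type) where
  src : S
  tgt : S
  read : List Δ
  write : List Δ
  mul : ℕ
  add : ℕ

namespace Tile

variable {S Δ : Type}

/-- Paths in the graph with edges `T`. -/
def IsPath (T : Set (Tile S Δ)) : S → List (Tile S Δ) → S → Prop
  | p, [], q => p = q
  | p, t :: τ, q => t ∈ T ∧ t.src = p ∧ IsPath T t.tgt τ q

def readWord (τ : List (Tile S Δ)) : List Δ := τ.flatMap read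

def writeWord (τ : List (Tile S Δ)) : List Δ := τ.flatMap write

def number (n : ℕ) (τ : List (Tile S Δ)) : ℕ := τ.foldl (fun n t => t.mul * n + t.add) n

@[simp] theorem readWord_nil : readWord ([] : List (Tile S Δ)) = [] := rfl
@[simp] theorem writeWord_nil : writeWord ([] : List (Tile S Δ)) = [] := rfl
@[simp] theorem number_nil (n : ℕ) : number n ([] : List (Tile S Δ)) = n := rfl
@[simp] theorem readWord_cons (t : Tile S Δ) (τ : List (Tile S Δ)) :
    readWord (t :: τ) = t.read ++ readWord τ := rfl
@[simp] theorem writeWord_cons (t : Tile S Δ) (τ : List (Tile S Δ)) :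
    writeWord (t :: τ) = t.write ++ writeWord τ := rfl
@[simp] theorem number_cons (n : ℕ) (t : Tile S Δ) (τ : List (Tile S Δ)) :
    number n (t :: τ) = number (t.mul * n + t.add) τ := rfl

/-- The queue machine has a run from `i` to `f`, with empty queue at both ends, that computes the
number `n`. -/
def Accepts (T : Set (Tile S Δ)) (i f : S) (n : ℕ) : Prop :=
  ∃ τ, IsPath T i τ f ∧ writeWord τ = readWord τ ∧ number 0 τ = n

end Tile

/-! ### Simulation of Turing machines by queue systems -/

/-- Queue symbols: tape symbols, a marker for the head, and a marker for the end of the tape. -/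
abbrev QSym (Γ : Type) := Γ ⊕ Bool

namespace QSym

abbrev head {Γ : Type} : QSym Γ := Sum.inr true
abbrev sep {Γ : Type} : QSym Γ := Sum.inr false

end QSym

open QSym

/-- The phases of a run: write the fixed beginning of the tape, guess binary digits, simulate in
state `q`, and finally empty the queue so that the words written and read agree. -/
inductive QState (Λ : Type)
  | start
  | digits
  | run (q : Λ)
  | flush

section Simulation

set_option linter.unusedSectionVars false

variable {Γ Λ : Type} [Inhabited Γ] [Inhabited Λ]

/-- The moves of the queue machine that simulates `M`. First it writes the head marker, the word
`w₀`, and a word of binary digits; then it simulates `M`, with the tape stored cyclically. -/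
inductive TMTile (M : TM0.Machine Γ Λ) (S : Set Λ) (w₀ : List Γ) (bit : Bool → Γ) :
    Tile (QState Λ) (QSym Γ) → Prop
  | start : TMTile M S w₀ bit ⟨.start, .digits, [], head :: w₀.map Sum.inl, 0, 1⟩
  | digit (b : Bool) :
      TMTile M S w₀ bit ⟨.digits, .digits, [], [Sum.inl (bit b)], 2, b.toNat⟩
  | endDigits : TMTile M S w₀ bit ⟨.digits, .run default, [], [sep], 1, 0⟩
  | rotate (q : Λ) (hq : q ∈ S) (c : QSym Γ) :
      TMTile M S w₀ bit ⟨.run q, .run q, [c], [c], 1, 0⟩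
  | extendRight (q : Λ) (hq : q ∈ S) :
      TMTile M S w₀ bit ⟨.run q, .run q, [head, sep], [head, Sum.inl default, sep], 1, 0⟩
  | extendLeft (q : Λ) (hq : q ∈ S) :
      TMTile M S w₀ bit ⟨.run q, .run q, [sep, head], [sep, Sum.inl default, head], 1, 0⟩
  | write (q q' : Λ) (hq : q ∈ S) (a b : Γ) (h : M q a = some (q', .write b)) :
      TMTile M S w₀ bit ⟨.run q, .run q', [head, Sum.inl a], [head, Sum.inl b], 1, 0⟩
  | right (q q' : Λ) (hq : q ∈ S) (a : Γ) (h : M q a = some (q', .move .right)) :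
      TMTile M S w₀ bit ⟨.run q, .run q', [head, Sum.inl a], [Sum.inl a, head], 1, 0⟩
  | left (q q' : Λ) (hq : q ∈ S) (a c : Γ) (h : M q a = some (q', .move .left)) :
      TMTile M S w₀ bit
        ⟨.run q, .run q', [Sum.inl c, head, Sum.inl a], [head, Sum.inl c, Sum.inl a], 1, 0⟩
  | halt (q : Λ) (hq : q ∈ S) (a : Γ) (h : M q a = none) :
      TMTile M S w₀ bit ⟨.run q, .flush, [head, Sum.inl a], [head, Sum.inl a], 1, 0⟩
  | flush (c : QSym Γ) : TMTile M S w₀ bit ⟨.flush, .flush, [c], [], 1, 0⟩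

theorem finite_tmTile [Finite Γ] (M : TM0.Machine Γ Λ) {S : Set Λ} (hS : S.Finite)
    (hM : TM0.Supports M S) (w₀ : List Γ) (bit : Bool → Γ) :
    {t | TMTile M S w₀ bit t}.Finite := by
  let Q : Set (QState Λ) := {.start, .digits, .flush} ∪ QState.run '' S
  have hQ : Q.Finite := ((Set.toFinite _).union (hS.image _))
  -- The starting move writes `w₀.length + 1` symbols; all other words have at most three.
  let W : Set (List (QSym Γ)) := {l | l.length ≤ w₀.length + 3}
  have hW : W.Finite := List.finite_length_le _ _
  have hN : {n : ℕ | n ≤ 2}.Finite := Set.finite_le_nat 2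
  have key := (hQ.prod (hQ.prod (hW.prod (hW.prod (hN.prod hN))))).image
    fun x => (⟨x.1, x.2.1, x.2.2.1, x.2.2.2.1, x.2.2.2.2.1, x.2.2.2.2.2⟩ :
      Tile (QState Λ) (QSym Γ))
  refine key.subset ?_
  intro t ht
  refine ⟨(t.src, t.tgt, t.read, t.write, t.mul, t.add), ?_, rfl⟩
  have hrun : ∀ q ∈ S, QState.run q ∈ Q := fun q hq => Or.inr ⟨q, hq, rfl⟩
  have hd := hrun _ hM.1
  have hsucc : ∀ {q q' : Λ} {a : Γ} {s}, q ∈ S → M q a = some (q', s) → QState.run q' ∈ Q :=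
    fun hq h => hrun _ (hM.2 (Option.mem_def.2 h) hq)
  have h1 : QState.start ∈ Q := by simp [Q]
  have h2 : QState.digits ∈ Q := by simp [Q]
  have h3 : QState.flush ∈ Q := by simp [Q]
  simp only [Set.mem_prod, W, Set.mem_ofPred_eq]
  cases ht with
  | start => simp [h1, h2]
  | digit b => cases b <;> simp [h2]
  | endDigits => simp [h2, hd]
  | rotate q hq c => simp [hrun q hq]
  | extendRight q hq => simp [hrun q hq]
  | extendLeft q hq => simp [hrun q hq]
  | write q q' hq a b h => simp [hrun q hq, hsucc hq h]
  | right q q' hq a h => simp [hrun q hq, hsucc hq h]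
  | left q q' hq a c h => simp [hrun q hq, hsucc hq h]
  | halt q hq a h => simp [hrun q hq, h3]
  | flush c => simp [h3]

/-- The queue with head marker in front that represents the tape with `L` to the left of the head
and `R` under and to the right of the head. -/
def tapeWord (L R : List Γ) : List (QSym Γ) :=
  head :: (R.map Sum.inl ++ sep :: L.reverse.map Sum.inl)

def Halts (M : TM0.Machine Γ Λ) (c : TM0.Cfg Γ Λ) : Prop :=
  ∃ c', TM0.Reaches M c c' ∧ TM0.step M c' = none

theorem Halts.of_step {M : TM0.Machine Γ Λ} {c c' : TM0.Cfg Γ Λ} (h : TM0.step M c = some c')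
    (h' : Halts M c') : Halts M c := by
  obtain ⟨d, hd, hd'⟩ := h'
  exact ⟨d, Relation.ReflTransGen.head h hd, hd'⟩

/-- A letter that occurs once marks the only place where a cyclic word can be cut. It is applied to
the head marker. -/
theorem _root_.List.IsRotated.tail_eq_of_notMem {α : Type*} {x : α} {l l' : List α}
    (h : x :: l ~r x :: l') (hx : x ∉ l') : l = l' := by
  obtain ⟨n, hn, h⟩ := List.isRotated_iff_mod.1 h
  rw [List.rotate_eq_drop_append_take hn] at h
  have h0 := List.take_append_drop n (x :: l)
  generalize List.drop n (x :: l) = B at h h0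
  generalize List.take n (x :: l) = A at h h0
  cases A with
  | nil => simp_all
  | cons a A =>
    cases B with
    | nil => simp_all
    | cons b B =>
      simp only [List.cons_append, List.cons.injEq] at h h0
      rw [← h.2, ← h0.1] at hx
      simp at hx

/-- Acceptance only compares total words, so a move might read symbols that are written later. The
markers exclude this: a queue containing `head` and `sep` has length at least two, and a read word
that overran it would contain `sep`. -/
theorem queue_step {Q s u r : List (QSym Γ)} (h : Q ++ s = u ++ r) (h1 : head ∈ Q) (h2 : sep ∈ Q)
    (hu : u.length ≤ 2 ∨ sep ∉ u) : ∃ Q', Q = u ++ Q' ∧ r = Q' ++ s := by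
  rcases List.append_eq_append_iff.1 h with ⟨v, rfl, rfl⟩ | ⟨v, rfl, rfl⟩
  · rcases hu with hu | hu
    · have : 2 ≤ Q.length := by
        rcases Q with _ | ⟨a, _ | ⟨b, Q⟩⟩
        · simp at h1
        · simp only [List.mem_singleton] at h1 h2
          rw [← h1] at h2
          simp at h2
        · simp
      rw [List.length_append] at hu
      have hv : v = [] := List.length_eq_zero_iff.1 (by omega)
      subst hv
      exact ⟨[], by simp⟩
    · exact absurd (List.mem_append_left _ h2) hu
  · exact ⟨v, rfl, rfl⟩

theorem cons_eq_tape {a : QSym Γ} {Q : List (QSym Γ)} {L R : List Γ}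
    (h : a :: Q = R.map Sum.inl ++ sep :: L.reverse.map Sum.inl) :
    (a = sep ∧ R = [] ∧ Q = L.reverse.map Sum.inl) ∨
      ∃ b R', a = Sum.inl b ∧ R = b :: R' ∧
        Q = R'.map Sum.inl ++ sep :: L.reverse.map Sum.inl := by
  cases R with
  | nil => simp only [List.map_nil, List.nil_append, List.cons.injEq] at h; simp [h.1, h.2]
  | cons b R =>
    simp only [List.map_cons, List.cons_append, List.cons.injEq] at h
    exact Or.inr ⟨b, R, h.1, rfl, h.2⟩

theorem append_singleton_eq_tape {c : QSym Γ} {Q : List (QSym Γ)} {L R : List Γ}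
    (h : Q ++ [c] = R.map Sum.inl ++ sep :: L.reverse.map Sum.inl) :
    (c = sep ∧ L = [] ∧ Q = R.map Sum.inl) ∨
      ∃ b L', c = Sum.inl b ∧ L = b :: L' ∧
        Q = R.map Sum.inl ++ sep :: L'.reverse.map Sum.inl := by
  cases L with
  | nil =>
    have := List.append_inj' h rfl
    simp_all
  | cons b L =>
    have h' : Q ++ [c] = (R.map Sum.inl ++ sep :: L.reverse.map Sum.inl) ++ [Sum.inl b] := by
      rw [h]; simp
    have := List.append_inj' h' rfl
    exact Or.inr ⟨b, L, by simpa using this.2, rfl, this.1⟩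

/-- This is why the extension moves leave the represented tape unchanged. -/
theorem mk_blank : ListBlank.mk [(default : Γ)] = ListBlank.mk [] :=
  Quotient.sound' (Or.inr ⟨1, rfl⟩)

variable {M : TM0.Machine Γ Λ} {S : Set Λ} {w₀ : List Γ} {bit : Bool → Γ}

/-- Soundness of the simulation. Up to rotation the queue always represents the current tape: a move
rotates it, adds a blank at an end of the tape, or performs one step of `M`, and `flush` can be
entered only from a halting configuration. -/
theorem halts_of_path (τ : List (Tile (QState Λ) (QSym Γ))) :
    ∀ (q : Λ) (Q : List (QSym Γ)) (L R : List Γ),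
      Tile.IsPath {t | TMTile M S w₀ bit t} (.run q) τ .flush →
      Q ++ Tile.writeWord τ = Tile.readWord τ → Q ~r tapeWord L R →
      Halts M ⟨q, Tape.mk' (ListBlank.mk L) (ListBlank.mk R)⟩ := by
  induction τ with
  | nil => intro q Q L R h; simp [Tile.IsPath] at h
  | cons t τ ih =>
    rintro q Q L R ⟨ht, hsrc, hp⟩ hw hQ
    have h1 : (head : QSym Γ) ∈ Q := hQ.mem_iff.2 (by simp [tapeWord])
    have h2 : (sep : QSym Γ) ∈ Q := hQ.mem_iff.2 (by simp [tapeWord])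
    rw [Tile.writeWord_cons, Tile.readWord_cons] at hw
    -- Only a left move reads three symbols, and `sep` is not among them.
    have hlen : t.read.length ≤ 2 ∨ (sep : QSym Γ) ∉ t.read := by
      cases ht <;> simp
    obtain ⟨Q', rfl, hw'⟩ := queue_step hw h1 h2 hlen
    rw [← List.append_assoc] at hw'
    have hrot : Q' ++ t.write ~r t.write ++ Q' := List.isRotated_append
    have cut1 : ∀ {l : List (QSym Γ)}, head :: l ~r tapeWord L R →
        l = R.map Sum.inl ++ sep :: L.reverse.map Sum.inl := fun h =>
      h.tail_eq_of_notMem (by simp)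
    cases ht with
    | start => simp at hsrc
    | digit b => simp at hsrc
    | endDigits => simp at hsrc
    | flush c => simp at hsrc
    | rotate q₁ hq c =>
      obtain rfl : q₁ = q := by simpa using hsrc
      exact ih _ _ L R hp hw'.symm (hrot.trans hQ)
    | extendRight q₁ hq =>
      obtain rfl : q₁ = q := by simpa using hsrc
      rcases cons_eq_tape (cut1 hQ) with ⟨-, rfl, rfl⟩ | ⟨b, R', h, -⟩
      · rw [← mk_blank]
        exact ih _ _ L [default] hp hw'.symm (by simpa [tapeWord] using hrot)
      · simp at h
    | extendLeft q₁ hq =>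
      obtain rfl : q₁ = q := by simpa using hsrc
      -- Cut at the head, the cyclic word ends with `sep`, so no cell lies to the left of the head.
      have h3 : head :: (Q' ++ [sep]) ~r tapeWord L R :=
        List.IsRotated.trans (List.isRotated_append (l := head :: Q') (l' := [sep])) hQ
      rcases append_singleton_eq_tape (cut1 h3) with ⟨-, rfl, rfl⟩ | ⟨b, R', h, -⟩
      · rw [← mk_blank]
        refine ih _ _ [default] R hp hw'.symm (hrot.trans ?_)
        have := List.isRotated_append (l := [sep, Sum.inl (default : Γ)])
          (l' := head :: R.map Sum.inl)
        simpa [tapeWord] using this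
      · simp at h
    | write q₁ q' hq a b h =>
      obtain rfl : q₁ = q := by simpa using hsrc
      rcases cons_eq_tape (cut1 hQ) with ⟨h', -⟩ | ⟨a', R', ha, rfl, rfl⟩
      · simp at h'
      · obtain rfl : a = a' := by simpa using ha
        refine Halts.of_step (c' := ⟨q', Tape.mk' (ListBlank.mk L) (ListBlank.mk (b :: R'))⟩) ?_
          (ih _ _ L (b :: R') hp hw'.symm (by simpa [tapeWord] using hrot))
        simp [TM0.step, Tape.mk', h, Tape.write]
    | right q₁ q' hq a h =>
      obtain rfl : q₁ = q := by simpa using hsrc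
      rcases cons_eq_tape (cut1 hQ) with ⟨h', -⟩ | ⟨a', R', ha, rfl, rfl⟩
      · simp at h'
      · obtain rfl : a = a' := by simpa using ha
        refine Halts.of_step (c' := ⟨q', Tape.mk' (ListBlank.mk (a :: L)) (ListBlank.mk R')⟩) ?_
          (ih _ _ (a :: L) R' hp hw'.symm (hrot.trans ?_))
        · simp [TM0.step, Tape.mk', h, Tape.move]
        · have := List.isRotated_append (l := [Sum.inl a])
            (l' := head :: (R'.map Sum.inl ++ sep :: L.reverse.map Sum.inl))
          simpa [tapeWord] using this
    | left q₁ q' hq a c h =>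
      obtain rfl : q₁ = q := by simpa using hsrc
      have h3 : head :: ((Sum.inl a :: Q') ++ [Sum.inl c]) ~r tapeWord L R :=
        List.IsRotated.trans
          (List.isRotated_append (l := head :: Sum.inl a :: Q') (l' := [Sum.inl c])) hQ
      rcases append_singleton_eq_tape (cut1 h3) with ⟨h', -⟩ | ⟨c', L', hc, rfl, h4⟩
      · simp at h'
      · obtain rfl : c = c' := by simpa using hc
        rcases cons_eq_tape h4 with ⟨h', -⟩ | ⟨a', R', ha, rfl, rfl⟩
        · simp at h'
        · obtain rfl : a = a' := by simpa using ha
          refine Halts.of_step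
            (c' := ⟨q', Tape.mk' (ListBlank.mk L') (ListBlank.mk (c :: a :: R'))⟩) ?_
            (ih _ _ L' (c :: a :: R') hp hw'.symm (by simpa [tapeWord] using hrot))
          simp [TM0.step, Tape.mk', h, Tape.move]
    | halt q₁ hq a h =>
      obtain rfl : q₁ = q := by simpa using hsrc
      rcases cons_eq_tape (cut1 hQ) with ⟨h', -⟩ | ⟨a', R', ha, rfl, rfl⟩
      · simp at h'
      · obtain rfl : a = a' := by simpa using ha
        exact ⟨_, Relation.ReflTransGen.refl, by simp [TM0.step, Tape.mk', h]⟩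

/-- From state `q` with queue `Q`, the queue machine can empty the queue in state `flush`,
without changing the number. -/
def CanFinish (T : Set (Tile (QState Λ) (QSym Γ))) (q : QState Λ) (Q : List (QSym Γ)) : Prop :=
  ∃ τ, Tile.IsPath T q τ .flush ∧ Q ++ Tile.writeWord τ = Tile.readWord τ ∧
    ∀ n, Tile.number n τ = n

theorem CanFinish.of_tile {T : Set (Tile (QState Λ) (QSym Γ))} {q q' : QState Λ}
    {u v Q : List (QSym Γ)} (ht : ⟨q, q', u, v, 1, 0⟩ ∈ T) (h : CanFinish T q' (Q ++ v)) :
    CanFinish T q (u ++ Q) := by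
  obtain ⟨τ, h1, h2, h3⟩ := h
  exact ⟨⟨q, q', u, v, 1, 0⟩ :: τ, ⟨ht, rfl, h1⟩, by simpa using h2, by simpa using h3⟩

theorem canFinish_flush (Q : List (QSym Γ)) :
    CanFinish {t | TMTile M S w₀ bit t} .flush Q := by
  induction Q with
  | nil => exact ⟨[], rfl, rfl, fun _ => rfl⟩
  | cons c Q ih =>
    refine CanFinish.of_tile (u := [c]) (v := []) (TMTile.flush c) ?_
    simpa using ih

/-- The rotating moves carry letters from the front to the end, so only the cyclic word matters for
completeness too. -/
theorem CanFinish.rotate {q : Λ} (hq : q ∈ S) {Q Q' : List (QSym Γ)} (hQ : Q ~r Q')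
    (h : CanFinish {t | TMTile M S w₀ bit t} (.run q) Q') :
    CanFinish {t | TMTile M S w₀ bit t} (.run q) Q := by
  obtain ⟨n, rfl⟩ := hQ
  induction n generalizing Q with
  | zero => simpa using h
  | succ n ih =>
    cases Q with
    | nil => simpa using h
    | cons c Q =>
      rw [List.rotate_cons_succ] at h
      exact CanFinish.of_tile (u := [c]) (TMTile.rotate q hq c) (ih h)

theorem canFinish_extendRight {q : Λ} (hq : q ∈ S) {L : List Γ}
    (h : CanFinish {t | TMTile M S w₀ bit t} (.run q) (tapeWord L [default])) :
    CanFinish {t | TMTile M S w₀ bit t} (.run q) (tapeWord L []) := by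
  refine CanFinish.of_tile (u := [head, sep]) (Q := L.reverse.map Sum.inl)
    (TMTile.extendRight q hq) (CanFinish.rotate hq List.isRotated_append ?_)
  simpa [tapeWord] using h

theorem canFinish_extendLeft {q : Λ} (hq : q ∈ S) {R : List Γ}
    (h : CanFinish {t | TMTile M S w₀ bit t} (.run q) (tapeWord [default] R)) :
    CanFinish {t | TMTile M S w₀ bit t} (.run q) (tapeWord [] R) := by
  have h0 : tapeWord [] R ~r [sep, head] ++ R.map Sum.inl := by
    have := List.isRotated_append (l := head :: R.map Sum.inl) (l' := [(sep : QSym Γ)])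
    simpa [tapeWord] using this
  refine CanFinish.rotate hq h0 (CanFinish.of_tile (TMTile.extendLeft q hq) ?_)
  refine CanFinish.rotate hq (Q' := tapeWord [default] R) ?_ h
  have h1 := List.isRotated_append (l := [sep, Sum.inl (default : Γ)])
    (l' := head :: R.map Sum.inl)
  have h2 := List.isRotated_append (l := R.map Sum.inl)
    (l' := [sep, Sum.inl (default : Γ), head])
  simp only [tapeWord, List.cons_append, List.nil_append, List.reverse_cons, List.reverse_nil,
    List.map_cons, List.map_nil] at h1 h2 ⊢
  exact h2.trans h1

/-- It suffices to consider tapes whose list of cells at and to the right of the head is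
nonempty. -/
theorem canFinish_of_cons {q : Λ} (hq : q ∈ S) {L R : List Γ}
    (h : ∀ a R', ListBlank.mk R = ListBlank.mk (a :: R') →
      CanFinish {t | TMTile M S w₀ bit t} (.run q) (tapeWord L (a :: R'))) :
    CanFinish {t | TMTile M S w₀ bit t} (.run q) (tapeWord L R) := by
  cases R with
  | nil => exact canFinish_extendRight hq (h _ _ mk_blank.symm)
  | cons a R => exact h a R rfl

theorem canFinish_of_cons_left {q : Λ} (hq : q ∈ S) {L R : List Γ}
    (h : ∀ a L', ListBlank.mk L = ListBlank.mk (a :: L') →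
      CanFinish {t | TMTile M S w₀ bit t} (.run q) (tapeWord (a :: L') R)) :
    CanFinish {t | TMTile M S w₀ bit t} (.run q) (tapeWord L R) := by
  cases L with
  | nil => exact canFinish_extendLeft hq (h _ _ mk_blank.symm)
  | cons a L => exact h a L rfl

/-- Completeness of the simulation, by induction backwards from the halting configuration. The lists
`L` and `R` are arbitrary representatives of the tape, since blanks may have to be added before a
step can be simulated. -/
theorem canFinish_of_halts (hM : TM0.Supports M S) {c : TM0.Cfg Γ Λ} (h : Halts M c)
    (hc : c.q ∈ S) (L R : List Γ) (hT : c.Tape = Tape.mk' (ListBlank.mk L) (ListBlank.mk R)) :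
    CanFinish {t | TMTile M S w₀ bit t} (.run c.q) (tapeWord L R) := by
  obtain ⟨d, hd, hd'⟩ := h
  induction hd using Relation.ReflTransGen.head_induction_on generalizing L R with
  | refl =>
    refine canFinish_of_cons hc fun a R' hR => ?_
    rw [hR] at hT
    have hM' : M d.q a = none := by
      obtain ⟨q, T⟩ := d
      subst hT
      simpa [TM0.step, Tape.mk'] using hd'
    have := CanFinish.of_tile (T := {t | TMTile M S w₀ bit t})
        (Q := R'.map Sum.inl ++ sep :: L.reverse.map Sum.inl)
      (TMTile.halt d.q hc a hM') (canFinish_flush (M := M) (S := S) (w₀ := w₀) (bit := bit) _)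
    simpa [tapeWord] using this
  | @head c c' hstep hreach ih =>
    have hc' : c'.q ∈ S := TM0.step_supports M hM hstep hc
    refine canFinish_of_cons hc fun a R' hR => ?_
    rw [hR] at hT
    obtain ⟨q, T⟩ := c
    subst hT
    simp only [TM0.step, Tape.mk', ListBlank.head_mk, List.headI, Option.mem_def,
      Option.map_eq_some_iff] at hstep
    obtain ⟨⟨q', s⟩, hs, rfl⟩ := hstep
    simp only at hc hc' ih ⊢
    match s, hs with
    | .write b, hs =>
      have := ih hc' L (b :: R') (by simp [Tape.write, Tape.mk'])
      refine CanFinish.of_tile (Q := R'.map Sum.inl ++ sep :: L.reverse.map Sum.inl)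
        (TMTile.write q q' hc a b hs) (CanFinish.rotate hc' List.isRotated_append ?_)
      simpa [tapeWord] using this
    | .move .right, hs =>
      have := ih hc' (a :: L) R' (by simp [Tape.move, Tape.mk'])
      refine CanFinish.of_tile (Q := R'.map Sum.inl ++ sep :: L.reverse.map Sum.inl)
        (TMTile.right q q' hc a hs) (CanFinish.rotate hc' List.isRotated_append ?_)
      refine CanFinish.rotate hc' ?_ this
      have h1 := List.isRotated_append (l := [Sum.inl a])
        (l' := head :: (R'.map Sum.inl ++ sep :: L.reverse.map Sum.inl))
      simpa [tapeWord] using h1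
    | .move .left, hs =>
      refine canFinish_of_cons_left hc fun c L' hL => ?_
      rw [hL] at ih
      have := ih hc' L' (c :: a :: R') (by simp [Tape.move, Tape.mk'])
      refine CanFinish.rotate hc (Q' := [Sum.inl c, head, Sum.inl a] ++
        (R'.map Sum.inl ++ sep :: L'.reverse.map Sum.inl)) ?_
        (CanFinish.of_tile (TMTile.left q q' hc a c hs) ?_)
      · have h1 := List.isRotated_append (l' := [Sum.inl c])
          (l := head :: Sum.inl a :: (R'.map Sum.inl ++ sep :: L'.reverse.map Sum.inl))
        simpa [tapeWord] using h1
      · refine CanFinish.rotate hc' List.isRotated_append ?_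
        simpa [tapeWord] using this

/-- The value of a word of binary digits, most significant digit first. -/
def binValue (n : ℕ) (l : List Bool) : ℕ := l.foldl (fun n b => 2 * n + b.toNat) n

/-- The guessing phase reads nothing and stays in one state, so it is free to produce any binary
word. -/
theorem path_digits_iff (τ : List (Tile (QState Λ) (QSym Γ))) :
    Tile.IsPath {t | TMTile M S w₀ bit t} .digits τ .flush ↔
      ∃ (l : List Bool) (τ' : List (Tile (QState Λ) (QSym Γ))),
        τ = l.map (fun b => ⟨.digits, .digits, [], [Sum.inl (bit b)], 2, b.toNat⟩) ++
          ⟨.digits, .run default, [], [sep], 1, 0⟩ :: τ' ∧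
        Tile.IsPath {t | TMTile M S w₀ bit t} (.run default) τ' .flush := by
  constructor
  · induction τ with
    | nil => intro h; simp [Tile.IsPath] at h
    | cons t τ ih =>
      rintro ⟨ht, hsrc, hp⟩
      cases ht with
      | digit b =>
        obtain ⟨l, τ', rfl, h⟩ := ih hp
        exact ⟨b :: l, τ', rfl, h⟩
      | endDigits => exact ⟨[], τ, rfl, hp⟩
      | _ => simp at hsrc
  · rintro ⟨l, τ', rfl, h⟩
    induction l with
    | nil => exact ⟨TMTile.endDigits, rfl, h⟩
    | cons b l ih => exact ⟨TMTile.digit b, rfl, ih⟩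

theorem number_eq_of_path_run {q : QState Λ} {τ : List (Tile (QState Λ) (QSym Γ))}
    (hq : q ≠ .start ∧ q ≠ .digits) (h : Tile.IsPath {t | TMTile M S w₀ bit t} q τ .flush)
    (n : ℕ) : Tile.number n τ = n := by
  induction τ generalizing q with
  | nil => rfl
  | cons t τ ih =>
    obtain ⟨ht, hsrc, hp⟩ := h
    subst hsrc
    rw [Tile.number_cons]
    cases ht <;> simp at hq <;> simp <;> exact ih (by simp) hp

theorem words_digits (l : List Bool) (τ : List (Tile (QState Λ) (QSym Γ))) (n : ℕ) :
    Tile.writeWord (l.map (fun b => (⟨.digits, .digits, [], [Sum.inl (bit b)], 2, b.toNat⟩ :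
        Tile (QState Λ) (QSym Γ))) ++ τ) = l.map (fun b => Sum.inl (bit b)) ++ Tile.writeWord τ ∧
      Tile.readWord (l.map (fun b => (⟨.digits, .digits, [], [Sum.inl (bit b)], 2, b.toNat⟩ :
        Tile (QState Λ) (QSym Γ))) ++ τ) = Tile.readWord τ ∧
      Tile.number n (l.map (fun b => (⟨.digits, .digits, [], [Sum.inl (bit b)], 2, b.toNat⟩ :
        Tile (QState Λ) (QSym Γ))) ++ τ) = Tile.number (binValue n l) τ := by
  induction l generalizing n with
  | nil => simp [binValue]
  | cons b l ih =>
    obtain ⟨h1, h2, -⟩ := ih n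
    obtain ⟨-, -, h3⟩ := ih (2 * n + b.toNat)
    simp only [List.map_cons, List.cons_append, Tile.writeWord_cons, Tile.readWord_cons,
      Tile.number_cons, h1, h2, h3]
    exact ⟨rfl, rfl, rfl⟩

/-- The queue machine accepts the numbers on whose digits, after `w₀`, the Turing machine
halts. -/
theorem accepts_tmTile_iff (hM : TM0.Supports M S) (n : ℕ) :
    Tile.Accepts {t | TMTile M S w₀ bit t} .start .flush n ↔
      ∃ l, binValue 1 l = n ∧ Halts M (TM0.init (w₀ ++ l.map bit)) := by
  have hinit : ∀ l : List Bool, (TM0.init (w₀ ++ l.map bit) : TM0.Cfg Γ Λ) =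
      ⟨default, Tape.mk' (ListBlank.mk []) (ListBlank.mk (w₀ ++ l.map bit))⟩ := fun l => rfl
  constructor
  · rintro ⟨_ | ⟨t, τ⟩, hp, hw, hn⟩
    · simp [Tile.IsPath] at hp
    · obtain ⟨ht, hsrc, hp⟩ := hp
      cases ht with
      | start =>
        obtain ⟨l, τ', rfl, hp'⟩ := (path_digits_iff τ).1 hp
        rw [Tile.writeWord_cons, Tile.readWord_cons, (words_digits l _ 0).1,
          (words_digits l _ 0).2.1] at hw
        rw [Tile.number_cons, (words_digits l _ _).2.2, Tile.number_cons] at hn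
        rw [number_eq_of_path_run (by simp) hp'] at hn
        refine ⟨l, by simpa using hn, ?_⟩
        rw [hinit]
        -- When the simulation begins, nothing has been read and the queue is exactly the initial
        -- tape.
        refine halts_of_path τ' default (tapeWord [] (w₀ ++ l.map bit)) _ _ hp' ?_
          (List.IsRotated.refl _)
        simpa [tapeWord, Function.comp_def] using hw
      | _ => simp at hsrc
  · rintro ⟨l, hl, h⟩
    rw [hinit] at h
    obtain ⟨τ, h1, h2, h3⟩ := canFinish_of_halts (w₀ := w₀) (bit := bit) hM h hM.1 _ _ rfl
    refine ⟨_ :: _, ⟨TMTile.start, rfl, (path_digits_iff _).2 ⟨l, τ, rfl, h1⟩⟩, ?_, ?_⟩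
    · rw [Tile.writeWord_cons, Tile.readWord_cons, (words_digits l _ 0).1, (words_digits l _ 0).2.1]
      simpa [tapeWord, Function.comp_def] using h2
    · rw [Tile.number_cons, (words_digits l _ _).2.2, Tile.number_cons, h3]
      simpa using hl

end Simulation

end APA

/-! ### Recursively enumerable sets of numbers as sets accepted by finite queue machines -/

namespace APA

open Turing

section Chain

open ToPartrec PartrecToTM2

/-- The code of a binary digit. -/
def digitSym : Bool → PartrecToTM2.Γ'
  | false => PartrecToTM2.Γ'.bit0
  | true => PartrecToTM2.Γ'.bit1

/-- `trNat` lists binary digits from the least significant one. Positivity is needed because zero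
has the empty expansion. -/
theorem trNat_double_add (n : ℕ) (hn : 0 < n) (b : Bool) :
    trNat (2 * n + b.toNat) = digitSym b :: trNat n := by
  have h0 : (n : Num) ≠ 0 := by exact_mod_cast hn.ne'
  unfold trNat
  obtain ⟨p, hp⟩ : ∃ p, (n : Num) = Num.pos p := by
    cases h : (n : Num) with
    | zero => exact absurd h h0
    | pos p => exact ⟨p, rfl⟩
  cases b
  · have : ((2 * n + false.toNat : ℕ) : Num) = Num.pos p.bit0 := by
      rw [Bool.toNat_false, add_zero, two_mul, Nat.cast_add, hp]
      exact Num.bit0_of_bit0 (Num.pos p)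
    rw [this, hp]; rfl
  · have : ((2 * n + true.toNat : ℕ) : Num) = Num.pos p.bit1 := by
      rw [Bool.toNat_true, two_mul, Nat.cast_add, Nat.cast_add, hp, Nat.cast_one]
      exact Num.bit1_of_bit1 (Num.pos p)
    rw [this, hp]; rfl

theorem trNat_binValue (l : List Bool) (n : ℕ) (hn : 0 < n) :
    trNat (binValue n l) = (l.map digitSym).reverse ++ trNat n := by
  induction l generalizing n with
  | nil => rfl
  | cons b l ih =>
    change trNat (binValue (2 * n + b.toNat) l) = _
    rw [ih _ (by omega), trNat_double_add n hn]
    simp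

/-- The starting value `1` acts as the leading binary digit, which every positive number has. -/
theorem exists_binValue (n : ℕ) (hn : 0 < n) : ∃ l, binValue 1 l = n := by
  induction n using Nat.strong_induction_on with
  | _ n ih =>
    by_cases h : n = 1
    · exact ⟨[], h.symm⟩
    · obtain ⟨l, hl⟩ := ih (n / 2) (by omega) (by omega)
      refine ⟨l ++ [decide (n % 2 = 1)], ?_⟩
      rw [binValue, List.foldl_append]
      change 2 * binValue 1 l + _ = n
      rw [hl]
      by_cases h2 : n % 2 = 1 <;> simp [h2] <;> omega

end Chain

section StackMachine

variable {K : Type} [DecidableEq K] {Γ : K → Type} {Λ σ : Type} [Inhabited Λ] [Inhabited σ]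

/-- The tape symbol for an entry of stack `k`, with a mark for the bottom of the stacks. -/
def stackSym (k : K) (b : Bool) (a : Γ k) : TM2to1.Γ' K Γ :=
  (b, Function.update (fun _ => none) k (some a))

theorem trInit_eq {k : K} {L : List (Γ k)} {a : Γ k} {l : List (Γ k)} (h : L.reverse = a :: l) :
    TM2to1.trInit k L = stackSym k true a :: l.map (stackSym k false) := by
  unfold TM2to1.trInit
  rw [h]
  rfl

theorem halts_iff_eval_dom (M : Λ → TM2.Stmt Γ Λ σ) (k : K) (L : List (Γ k)) :
    Halts (TM1to0.tr (TM2to1.tr M)) (TM0.init (TM2to1.trInit k L)) ↔ (TM2.eval M k L).Dom := by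
  rw [← TM2to1.tr_eval_dom, ← TM1to0.tr_eval]
  constructor
  · rintro ⟨d, hd, hd'⟩
    exact Part.dom_iff_mem.2 ⟨_, Part.mem_map _ (StateTransition.mem_eval.2 ⟨hd, hd'⟩)⟩
  · intro h
    obtain ⟨d, hd⟩ := Part.dom_iff_mem.1 (show (StateTransition.eval _ _).Dom from h)
    exact ⟨d, StateTransition.mem_eval.1 hd⟩

/-- A stack machine with finitely many states is simulated by a one-tape machine with finitely
many states and symbols. -/
theorem exists_machine_of_stackMachine [Finite K] [∀ k, Finite (Γ k)] [Finite σ]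
    (M : Λ → TM2.Stmt Γ Λ σ) {S : Finset Λ} (hS : TM2.Supports M S) (k : K) (a₁ a₂ : Γ k)
    (bit : Bool → Γ k) :
    ∃ (Γ' Λ' : Type) (_ : Inhabited Γ') (_ : Inhabited Λ') (M' : TM0.Machine Γ' Λ') (S' : Set Λ')
      (w₀ : List Γ') (bit' : Bool → Γ'), Finite Γ' ∧ S'.Finite ∧ TM0.Supports M' S' ∧
      ∀ l : List Bool, Halts M' (TM0.init (w₀ ++ l.map bit')) ↔
        (TM2.eval M k (a₁ :: a₂ :: l.map bit).reverse).Dom := by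
  have := Fintype.ofFinite σ
  refine ⟨TM2to1.Γ' K Γ, _, inferInstance, inferInstance, TM1to0.tr (TM2to1.tr M), _,
    -- Only the lowest stack entry carries the bottom mark. As it is the fixed symbol `a₁`, the
    -- guessed digits all get unmarked symbols.
    [stackSym k true a₁, stackSym k false a₂], fun b => stackSym k false (bit b),
    inferInstanceAs (Finite (Bool × ∀ k, Option (Γ k))), Finset.finite_toSet _,
    TM1to0.tr_supports _ (TM2to1.tr_supports _ hS), fun l => ?_⟩
  rw [← halts_iff_eval_dom, trInit_eq (List.reverse_reverse _), List.map_cons, List.map_map]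
  rfl

end StackMachine

open ToPartrec PartrecToTM2 in
theorem trNat_one : trNat 1 = [PartrecToTM2.Γ'.bit1] := rfl

open ToPartrec PartrecToTM2 in
/-- Turing machines with finitely many states and symbols that halt, on binary inputs, on the
domain of a code. -/
theorem exists_machine (c : ToPartrec.Code) :
    ∃ (Γ Λ : Type) (_ : Inhabited Γ) (_ : Inhabited Λ) (M : TM0.Machine Γ Λ) (S : Set Λ)
      (w₀ : List Γ) (bit : Bool → Γ), Finite Γ ∧ S.Finite ∧ TM0.Supports M S ∧
      ∀ l : List Bool, Halts M (TM0.init (w₀ ++ l.map bit)) ↔ (c.eval [binValue 1 l]).Dom := by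
  let _ : Inhabited PartrecToTM2.Λ' := ⟨trNormal c Cont'.halt⟩
  have : Finite K' := Set.finite_univ_iff.1
    ((Set.toFinite {K'.main, K'.rev, K'.aux, K'.stack}).subset
      fun k _ => by cases k <;> simp)
  have : Finite PartrecToTM2.Γ' := Set.finite_univ_iff.1 ((Set.toFinite
    {PartrecToTM2.Γ'.consₗ, .cons, .bit0, .bit1}).subset fun a _ => by cases a <;> simp)
  obtain ⟨Γ, Λ, i₁, i₂, M, S, w₀, bit, h₁, h₂, h₃, h⟩ := exists_machine_of_stackMachine
    PartrecToTM2.tr (PartrecToTM2.tr_supports c Cont'.halt) K'.main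
    PartrecToTM2.Γ'.cons PartrecToTM2.Γ'.bit1 digitSym
  refine ⟨Γ, Λ, i₁, i₂, M, S, w₀, bit, h₁, h₂, h₃, fun l => (h l).trans ?_⟩
  -- The stack has the least significant digit on top and `cons` at the bottom. The tape lists it
  -- from the bottom: `cons`, the leading digit `1`, then the digits in the order in which the queue
  -- machine guesses them.
  have hl : (PartrecToTM2.Γ'.cons :: PartrecToTM2.Γ'.bit1 :: l.map digitSym).reverse =
      trList [binValue 1 l] := by
    simp [trNat_binValue, trNat_one]
  rw [hl]
  have hi : PartrecToTM2.init c [binValue 1 l] = TM2.init K'.main (trList [binValue 1 l]) := by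
    unfold PartrecToTM2.init TM2.init
    congr 1
    funext k
    cases k <;> rfl
  have : (StateTransition.eval (TM2.step PartrecToTM2.tr)
      (PartrecToTM2.init c [binValue 1 l])).Dom ↔ (c.eval [binValue 1 l]).Dom := by
    rw [PartrecToTM2.tr_eval]; rfl
  rw [← this, hi]
  rfl

theorem exists_code_of_rePred {p : ℕ → Prop} (hp : REPred p) :
    ∃ c : ToPartrec.Code, ∀ n, (c.eval [n]).Dom ↔ p n := by
  have h : Partrec fun v : List.Vector ℕ 1 =>
      (Part.assert (p v.head) fun _ => Part.some ()).map fun _ => 0 :=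
    (Partrec.comp hp Computable.vector_head).map (Computable.const 0).to₂
  obtain ⟨c, hc⟩ := ToPartrec.Code.exists_code (Nat.Partrec'.part_iff.2 h)
  refine ⟨c, fun n => ?_⟩
  have := hc ⟨[n], rfl⟩
  change c.eval [n] = _ at this
  rw [this]
  simp [Part.assert, List.Vector.head]

/-- Renaming the states and the queue symbols. -/
def Tile.map {S Δ S' Δ' : Type} (f : S → S') (g : Δ → Δ') (t : Tile S Δ) : Tile S' Δ' :=
  ⟨f t.src, f t.tgt, t.read.map g, t.write.map g, t.mul, t.add⟩

/-- Injectivity of `f` is required only on the states in use, because the type of all states may be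
infinite while finitely many occur in moves. -/
theorem Tile.accepts_map_iff {S Δ S' Δ' : Type} {T : Set (Tile S Δ)} {s : Set S} {f : S → S'}
    (hf : Set.InjOn f s) {g : Δ → Δ'} (hg : Function.Injective g)
    (hT : ∀ t ∈ T, t.src ∈ s ∧ t.tgt ∈ s) {p q : S} (hp : p ∈ s) (hq : q ∈ s) (n : ℕ) :
    Accepts (Tile.map f g '' T) (f p) (f q) n ↔ Accepts T p q n := by
  have hread : ∀ τ : List (Tile S Δ), readWord (τ.map (Tile.map f g)) = (readWord τ).map g := by
    intro τ
    induction τ with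
    | nil => rfl
    | cons t τ ih => simp [ih, Tile.map]
  have hwrite : ∀ τ : List (Tile S Δ), writeWord (τ.map (Tile.map f g)) = (writeWord τ).map g := by
    intro τ
    induction τ with
    | nil => rfl
    | cons t τ ih => simp [ih, Tile.map]
  have hnum : ∀ (τ : List (Tile S Δ)) (n : ℕ), number n (τ.map (Tile.map f g)) = number n τ := by
    intro τ
    induction τ with
    | nil => intro n; rfl
    | cons t τ ih => intro n; simp [ih, Tile.map]
  constructor
  · rintro ⟨τ', h1, h2, h3⟩
    obtain ⟨τ, h, rfl⟩ : ∃ τ, IsPath T p τ q ∧ τ.map (Tile.map f g) = τ' := by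
      clear h2 h3
      induction τ' generalizing p with
      | nil => exact ⟨[], hf hp hq h1, rfl⟩
      | cons t' τ' ih =>
        obtain ⟨⟨t, ht, rfl⟩, hsrc, hpath⟩ := h1
        obtain ⟨τ, h, rfl⟩ := ih (hT t ht).2 hpath
        exact ⟨t :: τ, ⟨ht, hf (hT t ht).1 hp hsrc, h⟩, rfl⟩
    refine ⟨τ, h, ?_, by rw [← h3, hnum]⟩
    rw [hread, hwrite] at h2
    exact List.map_injective_iff.2 hg h2
  · rintro ⟨τ, h1, h2, h3⟩
    refine ⟨τ.map (Tile.map f g), ?_, by rw [hread, hwrite, h2], by rw [hnum, h3]⟩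
    clear h2 h3
    induction τ generalizing p with
    | nil => exact congrArg f h1
    | cons t τ ih =>
      obtain ⟨ht, hsrc, hpath⟩ := h1
      exact ⟨⟨t, ht, rfl⟩, congrArg f hsrc, ih (hT t ht).2 hpath⟩

/-- Every recursively enumerable set of positive numbers is accepted by a finite queue machine
with numbers as states and symbols. -/
theorem exists_tiles {p : ℕ → Prop} (hp : REPred p) :
    ∃ (B s i f : ℕ) (tiles : List (Tile ℕ ℕ)),
      (∀ t ∈ tiles, t.src ≤ s ∧ t.tgt ≤ s ∧ (∀ a ∈ t.read, 0 < a ∧ a < B) ∧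
        ∀ a ∈ t.write, 0 < a ∧ a < B) ∧ i ≤ s ∧ f ≤ s ∧
      ∀ n, 0 < n → (Tile.Accepts {t | t ∈ tiles} i f n ↔ p n) := by
  obtain ⟨c, hc⟩ := exists_code_of_rePred hp
  obtain ⟨Γ, Λ, _, _, M, S, w₀, bit, _, hS, hM, hh⟩ := exists_machine c
  have hfin := finite_tmTile M hS hM w₀ bit
  set T := {t | TMTile M S w₀ bit t} with hT
  let Q : Set (QState Λ) := {.start, .flush} ∪ (Tile.src '' T ∪ Tile.tgt '' T)
  have hQ : Q.Finite := (Set.toFinite _).union ((hfin.image _).union (hfin.image _))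
  obtain ⟨ν, hν⟩ := Set.countable_iff_exists_injOn.1 hQ.countable
  obtain ⟨k, ⟨e⟩⟩ := Finite.exists_equiv_fin (QSym Γ)
  obtain ⟨s, hs⟩ := (hQ.image ν).bddAbove
  have hs' : ∀ q ∈ Q, ν q ≤ s := fun q hq => hs ⟨q, hq, rfl⟩
  have hTQ : ∀ t ∈ T, t.src ∈ Q ∧ t.tgt ∈ Q :=
    fun t ht => ⟨Or.inr (Or.inl ⟨t, ht, rfl⟩), Or.inr (Or.inr ⟨t, ht, rfl⟩)⟩
  -- Symbols become nonzero digits in base `k + 1`, so that words will be determined by their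
  -- values.
  let γ : QSym Γ → ℕ := fun a => (e a : ℕ) + 1
  have hγ : Function.Injective γ := fun a b h => e.injective (Fin.ext (by simpa [γ] using h))
  have hT' : (Tile.map ν γ '' T).Finite := hfin.image _
  refine ⟨k + 1, s, ν .start, ν .flush, hT'.toFinset.toList, ?_, hs' _ (by simp [Q]),
    hs' _ (by simp [Q]), ?_⟩
  · intro t ht
    obtain ⟨t, htT, rfl⟩ : t ∈ Tile.map ν γ '' T := by simpa using ht
    refine ⟨hs' _ (hTQ t htT).1, hs' _ (hTQ t htT).2, ?_, ?_⟩ <;>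
    · intro a ha
      obtain ⟨x, -, rfl⟩ := List.mem_map.1 ha
      have := (e x).2
      simp only [γ]
      omega
  · intro n hn
    have : {t | t ∈ hT'.toFinset.toList} = Tile.map ν γ '' T := by ext t; simp
    rw [this, Tile.accepts_map_iff hν hγ hTQ (by simp [Q]) (by simp [Q]), hT,
      accepts_tmTile_iff hM]
    constructor
    · rintro ⟨l, rfl, h⟩
      exact (hc _).1 ((hh l).1 h)
    · intro h
      obtain ⟨l, rfl⟩ := exists_binValue n hn
      exact ⟨l, rfl, (hh l).2 ((hc _).2 h)⟩

end APA

namespace APA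

/-! ### Affine Parikh automata for queue systems -/

/-- The value of a word of digits in base `B`, continuing from the value `x`. -/
def wordVal (B x : ℕ) (u : List ℕ) : ℕ := u.foldl (fun x a => B * x + a) x

theorem wordVal_append (B x : ℕ) (u v : List ℕ) :
    wordVal B x (u ++ v) = wordVal B (wordVal B x u) v := List.foldl_append

/-- Appending a fixed word is thus an affine map of the value, which a single transition can
perform. -/
theorem wordVal_eq (B x : ℕ) (u : List ℕ) : wordVal B x u = B ^ u.length * x + wordVal B 0 u := by
  induction u generalizing x with
  | nil => simp [wordVal]
  | cons a u ih =>
    change wordVal B (B * x + a) u = B ^ (u.length + 1) * x + wordVal B (B * 0 + a) u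
    rw [ih (B * x + a), ih (B * 0 + a)]
    ring

/-- Remainder and quotient by `B` recover the last digit and the value of the rest. Excluding the
digit zero rules out leading zeros, so lengths agree as well. -/
theorem wordVal_injective {B : ℕ} : ∀ {u v : List ℕ}, (∀ a ∈ u, 0 < a ∧ a < B) →
    (∀ a ∈ v, 0 < a ∧ a < B) → wordVal B 0 u = wordVal B 0 v → u = v := by
  intro u
  induction u using List.reverseRecOn with
  | nil =>
    intro v _ hv h
    rcases List.eq_nil_or_concat v with rfl | ⟨v, b, rfl⟩
    · rfl
    · rw [List.concat_eq_append, wordVal_append] at h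
      have hb := hv b (by simp)
      simp [wordVal] at h
      omega
  | append_singleton u a ih =>
    intro v hu hv h
    have ha := hu a (by simp)
    rcases List.eq_nil_or_concat v with rfl | ⟨v, b, rfl⟩
    · rw [wordVal_append] at h
      simp [wordVal] at h
      omega
    · rw [List.concat_eq_append] at hv h ⊢
      have hb := hv b (by simp)
      rw [wordVal_append, wordVal_append] at h
      change B * wordVal B 0 u + a = B * wordVal B 0 v + b at h
      have h1 := congrArg (· % B) h
      have h2 := congrArg (· / B) h
      simp only [Nat.mul_add_mod, Nat.mod_eq_of_lt ha.2, Nat.mod_eq_of_lt hb.2] at h1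
      rw [Nat.mul_add_div (by omega), Nat.mul_add_div (by omega), Nat.div_eq_of_lt ha.2,
        Nat.div_eq_of_lt hb.2] at h2
      rw [h1, ih (fun a h => hu a (List.mem_append_left _ h))
        (fun a h => hv a (List.mem_append_left _ h)) (by simpa using h2)]

section QueueCode

set_option linter.unusedSectionVars false

variable {R : Type} (ι : ℕ → R)

/-- A diagonal matrix: entries missing after the diagonal are read as zero. -/
def diagRows (c₀ c₁ c₂ c₃ : ℕ) : List (List R) :=
  [[ι c₀], [ι 0, ι c₁], [ι 0, ι 0, ι c₂], [ι 0, ι 0, ι 0, ι c₃]]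

/-- The transition for a tile. The registers are the value of the word written to the queue, the
value of the word read from the queue, the value of the input word, and the number computed by the
queue machine. -/
def tileEntry (B a : ℕ) (t : Tile ℕ ℕ) : (ℕ × ℕ × ℕ) × List (List R) × List R :=
  ((t.src, a, t.tgt), diagRows ι (B ^ t.write.length) (B ^ t.read.length) 1 t.mul,
    [ι (wordVal B 0 t.write), ι (wordVal B 0 t.read), ι 0, ι t.add])

/-- The transition for the letter `a - m` of the input alphabet of size `k`. -/
def inputEntry (i m k a : ℕ) : (ℕ × ℕ × ℕ) × List (List R) × List R :=
  ((i, a, i), diagRows ι 1 1 (k + 1) 1, [ι 0, ι 0, ι (a - m + 1), ι 0])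

def queueEntry (B i : ℕ) (tiles : List (Tile ℕ ℕ)) (k a : ℕ) :
    (ℕ × ℕ × ℕ) × List (List R) × List R :=
  (tiles.mapIdx (tileEntry ι B))[a]?.getD (inputEntry ι i tiles.length k a)

/-- The number `n` computed by the queue machine encodes `e` and the value `N` of the input
word as `n = 2 ^ e * (2 * N + 1)`. -/
def queueConstraint (e : ℕ) : Fm R :=
  .and (.eq (.var 0) (.var 1))
    (.eq (.var 3) (.add (.scale (ι (2 ^ (e + 1))) (.var 2)) (.const (ι (2 ^ e)))))

/-- The automaton whose letters are the tiles, followed by `k` letters of an input alphabet that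
are read in the initial state. -/
def queueCode (B s i f : ℕ) (tiles : List (Tile ℕ ℕ)) (k e : ℕ) : Code R where
  maxState := s
  initial := i
  final := [f]
  predDim := 3
  trans := (List.range (tiles.length + k)).map (queueEntry ι B i tiles k)
  constraint := queueConstraint ι e

/-- The morphism that erases the first `m` letters. -/
def eraseMorph (m k : ℕ) : List (List ℕ) :=
  List.replicate m [] ++ (List.range k).map fun i => [i]

theorem morphOfCode_eraseMorph_of_lt {m k : ℕ} (a : Fin (m + k)) (ha : (a : ℕ) < m) :
    morphOfCode (eraseMorph m k) (m + k) k a = [] := by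
  have : (eraseMorph m k).getD (a : ℕ) [] = [] := by
    simp [eraseMorph, List.getD_eq_getElem?_getD, ha]
  rw [morphOfCode, this]
  rfl

theorem morphOfCode_eraseMorph_of_ge {m k : ℕ} (a : Fin (m + k)) (ha : m ≤ (a : ℕ)) :
    morphOfCode (eraseMorph m k) (m + k) k a = [⟨a - m, by omega⟩] := by
  have h : (a : ℕ) - m < k := by omega
  have : (eraseMorph m k).getD (a : ℕ) [] = [(a : ℕ) - m] := by
    simp [eraseMorph, List.getD_eq_getElem?_getD, List.getElem_append_right, ha]
  rw [morphOfCode, this]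
  simp [h]

theorem lookup_map_triple {β : Type} (src tgt : ℕ → ℕ) (g : ℕ → β) (l : List ℕ) (p a q : ℕ) :
    (l.map fun a => ((src a, a, tgt a), g a)).lookup (p, a, q) =
      if a ∈ l ∧ p = src a ∧ q = tgt a then some (g a) else none := by
  induction l with
  | nil => simp
  | cons b l ih =>
    rw [List.map_cons, List.lookup_cons, ih]
    by_cases hb : (p, a, q) = (src b, b, tgt b)
    · obtain ⟨rfl, rfl, rfl⟩ : p = src b ∧ a = b ∧ q = tgt b := by simpa using hb
      simp
    · have hb' : ((p, a, q) == (src b, b, tgt b)) = false := by simpa using hb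
      rw [hb']
      by_cases hab : a = b
      · subst hab
        have : ¬ (p = src a ∧ q = tgt a) := fun h => hb (by rw [h.1, h.2])
        simp [this]
      · simp [hab]

variable {K : Type} [CommSemiring K] [LinearOrder K] (val : R → K)

theorem affine_diag_apply (hval : ∀ n, val (ι n) = (n : K)) (c₀ c₁ c₂ c₃ d₀ d₁ d₂ d₃ : ℕ)
    (r : Fin 4 → ℕ) :
    (affineOfLists val 4 (diagRows ι c₀ c₁ c₂ c₃) [ι d₀, ι d₁, ι d₂, ι d₃]).apply
        (fun j => (r j : K)) =
      fun j => ((![c₀ * r 0 + d₀, c₁ * r 1 + d₁, c₂ * r 2 + d₂, c₃ * r 3 + d₃] j : ℕ) : K) := by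
  funext j
  fin_cases j <;>
    simp [Affine.apply, affineOfLists, diagRows, Matrix.mulVec, dotProduct, Fin.sum_univ_four,
      hval]

variable (B s i f : ℕ) (tiles : List (Tile ℕ ℕ)) (k e : ℕ)

theorem queueEntry_of_lt {a : ℕ} (ha : a < tiles.length) :
    queueEntry ι B i tiles k a = tileEntry ι B a tiles[a] := by
  simp [queueEntry, ha]

theorem queueEntry_of_ge {a : ℕ} (ha : tiles.length ≤ a) :
    queueEntry ι B i tiles k a = inputEntry ι i tiles.length k a := by
  rw [queueEntry, List.getElem?_eq_none (by simpa using ha)]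
  rfl

theorem queueEntry_eq (a : ℕ) : queueEntry ι B i tiles k a =
    (((queueEntry ι B i tiles k a).1.1, a, (queueEntry ι B i tiles k a).1.2.2),
      (queueEntry ι B i tiles k a).2) := by
  rcases lt_or_ge a tiles.length with h | h
  · rw [queueEntry_of_lt _ _ _ _ _ h]; rfl
  · rw [queueEntry_of_ge _ _ _ _ _ h]; rfl

theorem queueCode_lookup (p q : ℕ) (a : Fin (tiles.length + k)) :
    (queueCode ι B s i f tiles k e).trans.lookup (p, (a : ℕ), q) =
      if p = (queueEntry ι B i tiles k a).1.1 ∧ q = (queueEntry ι B i tiles k a).1.2.2 then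
        some (queueEntry ι B i tiles k a).2 else none := by
  have : (queueCode ι B s i f tiles k e).trans = (List.range (tiles.length + k)).map fun a =>
      (((queueEntry ι B i tiles k a).1.1, a, (queueEntry ι B i tiles k a).1.2.2),
        (queueEntry ι B i tiles k a).2) :=
    List.map_congr_left fun a _ => queueEntry_eq ι B i tiles k a
  rw [this, lookup_map_triple]
  simp

theorem mem_queueCode_delta (p q : Fin (s + 1)) (a : Fin (tiles.length + k)) :
    (p, a, q) ∈ ((queueCode ι B s i f tiles k e).toAPA val (tiles.length + k)).A.δ ↔
      (p : ℕ) = (queueEntry ι B i tiles k a).1.1 ∧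
        (q : ℕ) = (queueEntry ι B i tiles k a).1.2.2 := by
  change ((queueCode ι B s i f tiles k e).trans.lookup ((p : ℕ), (a : ℕ), (q : ℕ))).isSome ↔ _
  rw [queueCode_lookup]
  split_ifs with h <;> simp [h]

theorem queueCode_apply {p q : Fin (s + 1)} {a : Fin (tiles.length + k)}
    (h : (p, a, q) ∈ ((queueCode ι B s i f tiles k e).toAPA val (tiles.length + k)).A.δ)
    (x : Fin 4 → K) :
    (((queueCode ι B s i f tiles k e).toAPA val (tiles.length + k)).U (p, a, q)).apply x =
      (affineOfLists val 4 (queueEntry ι B i tiles k a).2.1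
        (queueEntry ι B i tiles k a).2.2).apply x := by
  rw [mem_queueCode_delta] at h
  change Affine.apply (affineOfLists val 4
    (((queueCode ι B s i f tiles k e).trans.lookup ((p : ℕ), (a : ℕ), (q : ℕ))).getD ([], [])).1
    (((queueCode ι B s i f tiles k e).trans.lookup ((p : ℕ), (a : ℕ), (q : ℕ))).getD ([], [])).2)
    x = _
  rw [queueCode_lookup, if_pos h]
  rfl

/-- Every letter is the name of one transition, so a letter alone fixes its source and its target.
-/
theorem queueCode_isDeterministic :
    ((queueCode ι B s i f tiles k e).toAPA val (tiles.length + k)).IsDeterministic := by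
  intro p a q q' h h'
  have h1 := ((mem_queueCode_delta ι val B s i f tiles k e p q a).1 h).2
  have h2 := ((mem_queueCode_delta ι val B s i f tiles k e p q' a).1 h').2
  exact Fin.ext (h1.trans h2.symm)

/-- The word over the input alphabet that is obtained by erasing the tiles. -/
def inputWord (m k : ℕ) (w : List (Fin (m + k))) : List (Fin k) :=
  w.flatMap (morphOfCode (eraseMorph m k) (m + k) k)

/-- The letters of an input word as nonzero digits in base `k + 1`. -/
def inputDigits {k : ℕ} (u : List (Fin k)) : List ℕ := u.map fun i : Fin k => (i : ℕ) + 1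

/-- The registers after the tiles `τ` and the input word `u`. -/
def registers (r : Fin 4 → ℕ) (τ : List (Tile ℕ ℕ)) (u : List (Fin k)) : Fin 4 → ℕ :=
  ![wordVal B (r 0) (Tile.writeWord τ), wordVal B (r 1) (Tile.readWord τ),
    wordVal (k + 1) (r 2) (inputDigits u), Tile.number (r 3) τ]

theorem registers_cons_tile (r : Fin 4 → ℕ) (t : Tile ℕ ℕ) (τ : List (Tile ℕ ℕ))
    (u : List (Fin k)) : registers B k r (t :: τ) u =
      registers B k ![wordVal B (r 0) t.write, wordVal B (r 1) t.read, r 2, t.mul * r 3 + t.add]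
        τ u := by
  simp [registers, wordVal_append]

theorem registers_cons_input (r : Fin 4 → ℕ) (a : Fin k) (τ : List (Tile ℕ ℕ))
    (u : List (Fin k)) : registers B k r τ (a :: u) =
      registers B k ![r 0, r 1, (k + 1) * r 2 + (a + 1), r 3] τ u := by
  simp [registers, inputDigits, wordVal]

theorem tile_apply (hval : ∀ n, val (ι n) = (n : K)) {a : ℕ} (ha : a < tiles.length)
    (r : Fin 4 → ℕ) :
    (affineOfLists val 4 (queueEntry ι B i tiles k a).2.1
        (queueEntry ι B i tiles k a).2.2).apply (fun j => (r j : K)) =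
      fun j => ((![wordVal B (r 0) tiles[a].write, wordVal B (r 1) tiles[a].read, r 2,
        tiles[a].mul * r 3 + tiles[a].add] j : ℕ) : K) := by
  rw [queueEntry_of_lt _ _ _ _ _ ha, tileEntry, affine_diag_apply ι val hval,
    wordVal_eq B (r 0), wordVal_eq B (r 1), one_mul, add_zero]

theorem input_apply (hval : ∀ n, val (ι n) = (n : K)) {a : ℕ} (ha : tiles.length ≤ a)
    (r : Fin 4 → ℕ) :
    (affineOfLists val 4 (queueEntry ι B i tiles k a).2.1
        (queueEntry ι B i tiles k a).2.2).apply (fun j => (r j : K)) =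
      fun j => ((![r 0, r 1, (k + 1) * r 2 + (a - tiles.length + 1), r 3] j : ℕ) : K) := by
  rw [queueEntry_of_ge _ _ _ _ _ ha, inputEntry, affine_diag_apply ι val hval]
  simp only [one_mul, add_zero]

/-- Input letters are loops, so deleting them leaves a path of tiles. Tiles and input letters change
different registers, so their interleaving is irrelevant. -/
theorem tiles_of_path (hval : ∀ n, val (ι n) = (n : K))
    (π : List (Fin (s + 1) × Fin (tiles.length + k) × Fin (s + 1))) :
    ∀ (p q : Fin (s + 1)) (r : Fin 4 → ℕ),
      ((queueCode ι B s i f tiles k e).toAPA val (tiles.length + k)).A.IsPath p π q →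
      ∃ τ, Tile.IsPath {t | t ∈ tiles} (p : ℕ) τ q ∧
        ((queueCode ι B s i f tiles k e).toAPA val (tiles.length + k)).pathMap π
            (fun j => (r j : K)) =
          fun j => (registers B k r τ (inputWord tiles.length k (π.map fun t => t.2.1)) j : K) := by
  induction π with
  | nil =>
    intro p q r h
    refine ⟨[], congrArg Fin.val h, ?_⟩
    funext j
    fin_cases j <;> rfl
  | cons t π ih =>
    obtain ⟨p', a, q'⟩ := t
    rintro p q r ⟨hδ, hp, hπ⟩
    obtain rfl : p' = p := hp
    have happly := queueCode_apply ι val B s i f tiles k e hδ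
    have hδ' := (mem_queueCode_delta ι val B s i f tiles k e p' q' a).1 hδ
    rcases lt_or_ge (a : ℕ) tiles.length with ha | ha
    · obtain ⟨τ, h1, h2⟩ := ih q' q _ hπ
      refine ⟨tiles[(a : ℕ)] :: τ, ⟨List.getElem_mem _, ?_, ?_⟩, ?_⟩
      · rw [hδ'.1, queueEntry_of_lt _ _ _ _ _ ha]; rfl
      · rw [hδ'.2, queueEntry_of_lt _ _ _ _ _ ha] at h1
        exact h1
      · have hu : inputWord tiles.length k (((p', a, q') :: π).map fun t => t.2.1) =
            inputWord tiles.length k (π.map fun t => t.2.1) := by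
          simp [inputWord, morphOfCode_eraseMorph_of_lt _ ha]
        rw [hu, registers_cons_tile, ← h2]
        exact congrArg (AffineParikhAutomaton.pathMap _ π)
          ((happly _).trans (tile_apply ι val B i tiles k hval ha r))
    · obtain ⟨τ, h1, h2⟩ := ih q' q _ hπ
      have hpq : (q' : ℕ) = p' := by
        rw [hδ'.1, hδ'.2, queueEntry_of_ge _ _ _ _ _ ha]; rfl
      refine ⟨τ, hpq ▸ h1, ?_⟩
      have hu : inputWord tiles.length k (((p', a, q') :: π).map fun t => t.2.1) =
          ⟨a - tiles.length, by omega⟩ :: inputWord tiles.length k (π.map fun t => t.2.1) := by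
        simp [inputWord, morphOfCode_eraseMorph_of_ge _ ha]
      rw [hu, registers_cons_input, ← h2]
      exact congrArg (AffineParikhAutomaton.pathMap _ π)
        ((happly _).trans (input_apply ι val B i tiles k hval ha r))

theorem path_of_tiles (hval : ∀ n, val (ι n) = (n : K))
    (htiles : ∀ t ∈ tiles, t.src ≤ s ∧ t.tgt ≤ s) (τ : List (Tile ℕ ℕ)) :
    ∀ (p q : Fin (s + 1)) (r : Fin 4 → ℕ), Tile.IsPath {t | t ∈ tiles} (p : ℕ) τ q →
      ∃ π : List (Fin (s + 1) × Fin (tiles.length + k) × Fin (s + 1)),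
        ((queueCode ι B s i f tiles k e).toAPA val (tiles.length + k)).A.IsPath p π q ∧
        inputWord tiles.length k (π.map fun t => t.2.1) = [] ∧
        ((queueCode ι B s i f tiles k e).toAPA val (tiles.length + k)).pathMap π
            (fun j => (r j : K)) = fun j => (registers B k r τ [] j : K) := by
  induction τ with
  | nil =>
    intro p q r h
    refine ⟨[], Fin.ext h, rfl, ?_⟩
    funext j
    fin_cases j <;> rfl
  | cons t τ ih =>
    rintro p q r ⟨ht, hp, hτ⟩
    obtain ⟨a, ha, rfl⟩ := List.getElem_of_mem ht
    have hs := htiles _ ht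
    obtain ⟨π, h1, h2, h3⟩ := ih ⟨tiles[a].tgt, by omega⟩ q _ hτ
    have hδ : ((p, ⟨a, by omega⟩, ⟨tiles[a].tgt, by omega⟩) :
        Fin (s + 1) × Fin (tiles.length + k) × Fin (s + 1)) ∈
        ((queueCode ι B s i f tiles k e).toAPA val (tiles.length + k)).A.δ := by
      rw [mem_queueCode_delta, queueEntry_of_lt _ _ _ _ _ ha]
      exact ⟨hp.symm, rfl⟩
    refine ⟨(p, ⟨a, by omega⟩, ⟨tiles[a].tgt, by omega⟩) :: π, ⟨hδ, rfl, h1⟩, ?_, ?_⟩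
    · rw [List.map_cons, inputWord, List.flatMap_cons, morphOfCode_eraseMorph_of_lt _ ha]
      exact h2
    · rw [registers_cons_tile, ← h3]
      exact congrArg (AffineParikhAutomaton.pathMap _ π)
        ((queueCode_apply ι val B s i f tiles k e hδ _).trans
          (tile_apply ι val B i tiles k hval ha r))

/-- The whole input is read first, by loops in the initial state, before any tile is used. -/
theorem path_of_tiles_of_input (hval : ∀ n, val (ι n) = (n : K)) (hi : i ≤ s)
    (htiles : ∀ t ∈ tiles, t.src ≤ s ∧ t.tgt ≤ s) {τ : List (Tile ℕ ℕ)} {q : Fin (s + 1)}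
    (hτ : Tile.IsPath {t | t ∈ tiles} i τ q) (u : List (Fin k)) :
    ∀ r : Fin 4 → ℕ,
      ∃ π : List (Fin (s + 1) × Fin (tiles.length + k) × Fin (s + 1)),
        ((queueCode ι B s i f tiles k e).toAPA val (tiles.length + k)).A.IsPath
          (⟨i, by omega⟩ : Fin (s + 1)) π q ∧
        inputWord tiles.length k (π.map fun t => t.2.1) = u ∧
        ((queueCode ι B s i f tiles k e).toAPA val (tiles.length + k)).pathMap π
            (fun j => (r j : K)) = fun j => (registers B k r τ u j : K) := by
  induction u with
  | nil => exact fun r => path_of_tiles ι val B s i f tiles k e hval htiles τ _ q r hτ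
  | cons b u ih =>
    intro r
    obtain ⟨π, h1, h2, h3⟩ := ih ![r 0, r 1, (k + 1) * r 2 + (b + 1), r 3]
    let a : Fin (tiles.length + k) := ⟨tiles.length + b, by omega⟩
    have ha : tiles.length ≤ (a : ℕ) := Nat.le_add_right _ _
    have hab : (a : ℕ) - tiles.length = b := Nat.add_sub_cancel_left _ _
    have hδ : ((⟨i, by omega⟩, a, ⟨i, by omega⟩) :
        Fin (s + 1) × Fin (tiles.length + k) × Fin (s + 1)) ∈
        ((queueCode ι B s i f tiles k e).toAPA val (tiles.length + k)).A.δ := by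
      rw [mem_queueCode_delta, queueEntry_of_ge _ _ _ _ _ ha]
      exact ⟨rfl, rfl⟩
    refine ⟨(⟨i, by omega⟩, a, ⟨i, by omega⟩) :: π, ⟨hδ, rfl, h1⟩, ?_, ?_⟩
    · rw [List.map_cons, inputWord, List.flatMap_cons, morphOfCode_eraseMorph_of_ge _ ha]
      exact congrArg₂ List.cons (Fin.ext hab) h2
    · have := input_apply ι val B i tiles k hval ha r
      rw [hab] at this
      rw [registers_cons_input, ← h3]
      exact congrArg (AffineParikhAutomaton.pathMap _ π)
        ((queueCode_apply ι val B s i f tiles k e hδ _).trans this)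

theorem mem_queueConstraint [CharZero K] (hval : ∀ n, val (ι n) = (n : K)) (r : Fin 4 → ℕ) :
    (fun j => (r j : K)) ∈ (queueConstraint ι e).toSet val 4 ↔
      r 0 = r 1 ∧ r 3 = 2 ^ e * (2 * r 2 + 1) := by
  have h : (2 : K) ^ (e + 1) * (r 2 : K) + 2 ^ e = ((2 ^ e * (2 * r 2 + 1) : ℕ) : K) := by
    push_cast; ring
  change (((r 0 : ℕ) : K) = ((r 1 : ℕ) : K) ∧
    ((r 3 : ℕ) : K) = val (ι (2 ^ (e + 1))) * ((r 2 : ℕ) : K) + val (ι (2 ^ e))) ↔ _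
  rw [hval, hval, Nat.cast_pow, Nat.cast_pow, Nat.cast_ofNat, h, Nat.cast_inj, Nat.cast_inj]

/-- The registers stay natural numbers, and characteristic zero makes equations between them true in
`K` only if they hold in `ℕ`. Equality of the first two registers then means that the written and
read words coincide, as both consist of nonzero digits below `B`. -/
theorem queueCode_image [CharZero K] (hval : ∀ n, val (ι n) = (n : K)) (hi : i ≤ s)
    (htiles : ∀ t ∈ tiles, t.src ≤ s ∧ t.tgt ≤ s ∧ (∀ a ∈ t.read, 0 < a ∧ a < B) ∧
        ∀ a ∈ t.write, 0 < a ∧ a < B) (hf : f ≤ s) :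
    morphImage (morphOfCode (eraseMorph tiles.length k) (tiles.length + k) k)
        ((queueCode ι B s i f tiles k e).toAPA val (tiles.length + k)).language =
      {u | Tile.Accepts {t | t ∈ tiles} i f
        (2 ^ e * (2 * wordVal (k + 1) 0 (inputDigits u) + 1))} := by
  have hinit : ((queueCode ι B s i f tiles k e).toAPA val (tiles.length + k)).A.q₀ =
      (⟨i, by omega⟩ : Fin (s + 1)) := Fin.ext (Nat.mod_eq_of_lt (Nat.lt_succ_of_le hi))
  have h0 : (0 : Fin 4 → K) = fun j => (((0 : Fin 4 → ℕ) j : ℕ) : K) := by funext j; simp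
  have hdig : ∀ {τ : List (Tile ℕ ℕ)} {p q : ℕ}, Tile.IsPath {t | t ∈ tiles} p τ q →
      (∀ a ∈ Tile.writeWord τ, 0 < a ∧ a < B) ∧ ∀ a ∈ Tile.readWord τ, 0 < a ∧ a < B := by
    intro τ
    induction τ with
    | nil => simp
    | cons t τ ih =>
      rintro p q ⟨ht, -, h⟩
      have := htiles t ht
      have := ih h
      simp only [Tile.writeWord_cons, Tile.readWord_cons, List.mem_append]
      grind
  ext u
  constructor
  · rintro ⟨w, ⟨π, ⟨q, hq, hπ⟩, hmem, rfl⟩, rfl⟩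
    rw [hinit] at hπ
    obtain ⟨τ, h1, h2⟩ := tiles_of_path ι val B s i f tiles k e hval π _ _ 0 hπ
    have hmem' := (mem_queueConstraint ι val e hval _).1
      (Eq.mp (congrArg (· ∈ (queueConstraint ι e).toSet val 4) ((congrArg _ h0).trans h2)) hmem)
    have hqf : (q : Fin (s + 1)).val = f := List.mem_singleton.1 hq
    rw [hqf] at h1
    exact ⟨τ, h1, wordVal_injective (hdig h1).1 (hdig h1).2 hmem'.1, hmem'.2⟩
  · rintro ⟨τ, h1, h2, h3⟩
    obtain ⟨π, h4, h5, h6⟩ := path_of_tiles_of_input ι val B s i f tiles k e hval hi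
      (fun t ht => ⟨(htiles t ht).1, (htiles t ht).2.1⟩) (q := ⟨f, by omega⟩) h1 u 0
    refine ⟨_, ⟨π, ⟨(⟨f, by omega⟩ : Fin (s + 1)), List.mem_singleton.2 rfl, ?_⟩, ?_, rfl⟩, h5⟩
    · rw [hinit]; exact h4
    · exact Eq.mpr (congrArg (· ∈ (queueConstraint ι e).toSet val 4) ((congrArg _ h0).trans h6))
        ((mem_queueConstraint ι val e hval _).2 ⟨congrArg (wordVal B 0) h2, h3⟩)

end QueueCode

end APA

namespace APA

/-! ### Computability of the construction -/

theorem primrec₂_pow : Primrec₂ ((· ^ ·) : ℕ → ℕ → ℕ) := Primrec₂.unpaired'.1 Nat.Primrec.pow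

theorem rePred_comp {α β : Type} [Primcodable α] [Primcodable β] {p : β → Prop} {f : α → β}
    (hp : REPred p) (hf : Computable f) : REPred fun a => p (f a) :=
  Partrec.comp hp hf

theorem rePred_exists {α β : Type} [Primcodable α] [Denumerable β] {p : α → β → Prop}
    (hp : PrimrecRel p) : REPred fun a => ∃ b, p a b := by
  classical
  have h : Computable₂ fun (a : α) (n : ℕ) => decide (p a (Denumerable.ofNat β n)) :=
    (hp.comp Primrec.fst ((Primrec.ofNat β).comp Primrec.snd)).decide.to_comp
  refine (Partrec.rfind h.partrec₂).dom_re.of_eq fun a => ?_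
  rw [Nat.rfind_dom]
  constructor
  · rintro ⟨n, hn, -⟩
    exact ⟨_, by simpa using hn⟩
  · rintro ⟨b, hb⟩
    exact ⟨Encodable.encode b, by simpa using hb, fun _ => trivial⟩

section Encoding

variable {R : Type} [Denumerable R]

theorem primrec_const : Primrec (Tm.const : R → Tm R) :=
  Primrec.encode_iff.1 (Primrec.succ.comp
    (Primrec.nat_mul.comp (Primrec.const 4) Primrec.encode))

theorem primrec₂_add : Primrec₂ (Tm.add : Tm R → Tm R → Tm R) :=
  Primrec.encode_iff.1 (Primrec.nat_add.comp (Primrec.nat_mul.comp (Primrec.const 4)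
    (Primrec₂.natPair.comp (Primrec.encode.comp Primrec.fst) (Primrec.encode.comp Primrec.snd)))
    (Primrec.const 2))

theorem primrec₂_scale : Primrec₂ (Tm.scale : R → Tm R → Tm R) :=
  Primrec.encode_iff.1 (Primrec.nat_add.comp (Primrec.nat_mul.comp (Primrec.const 4)
    (Primrec₂.natPair.comp (Primrec.encode.comp Primrec.fst) (Primrec.encode.comp Primrec.snd)))
    (Primrec.const 3))

theorem primrec₂_eq : Primrec₂ (Fm.eq : Tm R → Tm R → Fm R) :=
  Primrec.encode_iff.1 (Primrec.nat_add.comp (Primrec.nat_mul.comp (Primrec.const 5)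
    (Primrec₂.natPair.comp (Primrec.encode.comp Primrec.fst) (Primrec.encode.comp Primrec.snd)))
    (Primrec.const 1))

theorem primrec₂_and : Primrec₂ (Fm.and : Fm R → Fm R → Fm R) :=
  Primrec.encode_iff.1 (Primrec.nat_add.comp (Primrec.nat_mul.comp (Primrec.const 5)
    (Primrec₂.natPair.comp (Primrec.encode.comp Primrec.fst) (Primrec.encode.comp Primrec.snd)))
    (Primrec.const 3))

variable {ι : ℕ → R} (hι : Primrec ι)

include hι

theorem primrec_queueConstraint : Primrec (queueConstraint ι) := by
  have h1 : Primrec fun e : ℕ => ι (2 ^ (e + 1)) :=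
    hι.comp (primrec₂_pow.comp (Primrec.const 2) Primrec.succ)
  have h2 : Primrec fun e : ℕ => ι (2 ^ e) :=
    hι.comp (primrec₂_pow.comp (Primrec.const 2) Primrec.id)
  exact primrec₂_and.comp (Primrec.const _) (primrec₂_eq.comp (Primrec.const _)
    (primrec₂_add.comp (primrec₂_scale.comp h1 (Primrec.const _)) (primrec_const.comp h2)))

theorem primrec₂_inputEntry (i m : ℕ) : Primrec₂ fun k a => inputEntry ι i m k a := by
  have ha : Primrec fun p : ℕ × ℕ => p.2 := Primrec.snd
  have h1 : Primrec fun p : ℕ × ℕ => ι (p.1 + 1) := hι.comp (Primrec.succ.comp Primrec.fst)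
  have h2 : Primrec fun p : ℕ × ℕ => ι (p.2 - m + 1) :=
    hι.comp (Primrec.succ.comp (Primrec.nat_sub.comp ha (Primrec.const m)))
  have hk : Primrec fun p : ℕ × ℕ => (i, p.2, i) :=
    (Primrec.const i).pair (ha.pair (Primrec.const i))
  have hr : Primrec fun p : ℕ × ℕ => diagRows ι 1 1 (p.1 + 1) 1 :=
    Primrec.list_cons.comp (Primrec.const _) (Primrec.list_cons.comp (Primrec.const _)
      (Primrec.list_cons.comp (Primrec.list_cons.comp (Primrec.const _)
        (Primrec.list_cons.comp (Primrec.const _) (Primrec.list_cons.comp h1 (Primrec.const _))))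
        (Primrec.const _)))
  have hv : Primrec fun p : ℕ × ℕ => [ι 0, ι 0, ι (p.2 - m + 1), ι 0] :=
    Primrec.list_cons.comp (Primrec.const _) (Primrec.list_cons.comp (Primrec.const _)
      (Primrec.list_cons.comp h2 (Primrec.const _)))
  exact hk.pair (hr.pair hv)

/-- The tiles are a fixed finite table. Only the input letters depend on `k`, and only two constants
of the constraint depend on `e`. -/
theorem primrec_queueCode (B s i f : ℕ) (tiles : List (Tile ℕ ℕ)) :
    Primrec fun p : ℕ × ℕ => queueCode ι B s i f tiles p.1 p.2 := by
  have hentry : Primrec₂ fun k a => queueEntry ι B i tiles k a :=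
    Primrec.option_getD.comp ((Primrec.list_getElem?₁ _).comp Primrec.snd)
      (primrec₂_inputEntry hι i tiles.length)
  have htrans : Primrec fun p : ℕ × ℕ =>
      (List.range (tiles.length + p.1)).map (queueEntry ι B i tiles p.1) :=
    Primrec.list_map
      (Primrec.list_range.comp (Primrec.nat_add.comp (Primrec.const _) Primrec.fst))
      (hentry.comp (Primrec.fst.comp Primrec.fst) Primrec.snd)
  have hprod := (Primrec.const s).pair ((Primrec.const i).pair ((Primrec.const [f]).pair
    ((Primrec.const 3).pair (htrans.pair ((primrec_queueConstraint hι).comp Primrec.snd)))))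
  exact (Primrec.of_equiv_symm (e := Code.equivProd R)).comp hprod

end Encoding

theorem primrec₂_eraseMorph : Primrec₂ eraseMorph := by
  have h1 : Primrec fun p : ℕ × ℕ => List.replicate p.1 ([] : List ℕ) :=
    (Primrec.list_map (Primrec.list_range.comp Primrec.fst) (Primrec₂.const [])).of_eq fun p => by
      simp [List.map_const']
  have h2 : Primrec fun p : ℕ × ℕ => (List.range p.2).map fun i => [i] :=
    Primrec.list_map (Primrec.list_range.comp Primrec.snd)
      (Primrec.list_cons.comp Primrec.snd (Primrec.const [])).to₂
  exact Primrec.list_append.comp h1 h2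

/-! ### Queue systems for enumerable relations -/

/-- One step of the division of `p.2` by powers of `2`. -/
def halve (p : ℕ × ℕ) : ℕ × ℕ := if p.2 % 2 = 0 then (p.1 + 1, p.2 / 2) else p

/-- The inverse of `(e, N) ↦ 2 ^ e * (2 * N + 1)`. -/
def oddSplit (n : ℕ) : ℕ × ℕ := ((halve^[n] (0, n)).1, (halve^[n] (0, n)).2 / 2)

/-- After `e` halvings an odd number is reached, which `halve` fixes; surplus iterations do no harm.
-/
theorem iterate_halve (e N a : ℕ) : ∀ n, e ≤ n →
    halve^[n] (a, 2 ^ e * (2 * N + 1)) = (a + e, 2 * N + 1) := by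
  induction e generalizing a with
  | zero =>
    intro n _
    have : halve (a, 2 ^ 0 * (2 * N + 1)) = (a, 2 ^ 0 * (2 * N + 1)) := by
      simp [halve]
    rw [Function.iterate_fixed this]
    simp
  | succ e ih =>
    intro n hn
    obtain ⟨n, rfl⟩ : ∃ m, n = m + 1 := ⟨n - 1, by omega⟩
    have : halve (a, 2 ^ (e + 1) * (2 * N + 1)) = (a + 1, 2 ^ e * (2 * N + 1)) := by
      have h : 2 ^ (e + 1) * (2 * N + 1) = 2 * (2 ^ e * (2 * N + 1)) := by ring
      simp [halve, h]
    rw [Function.iterate_succ_apply, this, ih _ _ (by omega)]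
    simp [add_assoc, add_comm 1]

theorem oddSplit_eq (e N : ℕ) : oddSplit (2 ^ e * (2 * N + 1)) = (e, N) := by
  have h : e ≤ 2 ^ e * (2 * N + 1) :=
    (Nat.lt_two_pow_self).le.trans (Nat.le_mul_of_pos_right _ (by omega))
  rw [oddSplit, iterate_halve e N 0 _ h]
  simp
  omega

theorem primrec_oddSplit : Primrec oddSplit := by
  have hh : Primrec halve := Primrec.ite
    (Primrec.eq.comp (Primrec.nat_mod.comp Primrec.snd (Primrec.const 2)) (Primrec.const 0))
    ((Primrec.succ.comp Primrec.fst).pair (Primrec.nat_div.comp Primrec.snd (Primrec.const 2)))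
    Primrec.id
  have h : Primrec fun n : ℕ => halve^[n] (0, n) :=
    Primrec.nat_iterate Primrec.id ((Primrec.const 0).pair Primrec.id) (hh.comp Primrec.snd).to₂
  exact (Primrec.fst.comp h).pair (Primrec.nat_div.comp (Primrec.snd.comp h) (Primrec.const 2))

/-- For every recursively enumerable relation `T` there are a queue machine and automata, computable
from `k` and `e`, whose images under the erasing morphism are the languages of the words `u` with
`T e N`, where `N` is the value of `u`. -/
theorem exists_queueCode {T : ℕ → ℕ → Prop} (hT : REPred fun p : ℕ × ℕ => T p.1 p.2) :
    ∃ (B s i f : ℕ) (tiles : List (Tile ℕ ℕ)),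
      ∀ {R K : Type} [CommSemiring K] [LinearOrder K] [CharZero K] (ι : ℕ → R) (val : R → K),
        (∀ n, val (ι n) = (n : K)) → ∀ k e,
          morphImage (morphOfCode (eraseMorph tiles.length k) (tiles.length + k) k)
            ((queueCode ι B s i f tiles k e).toAPA val (tiles.length + k)).language =
              {u | T e (wordVal (k + 1) 0 (inputDigits u))} := by
  have hp : REPred fun n => T (oddSplit n).1 (oddSplit n).2 :=
    rePred_comp hT primrec_oddSplit.to_comp
  obtain ⟨B, s, i, f, tiles, htiles, hi, hf, h⟩ := exists_tiles hp
  refine ⟨B, s, i, f, tiles, fun ι val hval k e => ?_⟩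
  rw [queueCode_image ι val B s i f tiles k e hval hi htiles hf]
  ext u
  change Tile.Accepts _ _ _ _ ↔ T _ _
  -- The queue machine is controlled on positive numbers only, and `2 ^ e * (2 * N + 1)` is
  -- positive.
  rw [h _ (by positivity), oddSplit_eq]

/-! ### Enumerability of the languages of Turing machines -/

section TuringMachines

open Turing

theorem lookup_eq_foldr {α β : Type} [DecidableEq α] [BEq α] [LawfulBEq α] (l : List (α × β))
    (a : α) :
    l.lookup a = l.foldr (fun b o => if a = b.1 then some b.2 else o) none := by
  induction l with
  | nil => rfl
  | cons b l ih =>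
    obtain ⟨x, y⟩ := b
    rw [List.lookup_cons, List.foldr_cons, ← ih]
    by_cases h : a = x
    · simp [h]
    · rw [beq_false_of_ne h, if_neg h]

theorem primrec₂_lookup {α β : Type} [Primcodable α] [DecidableEq α] [BEq α] [LawfulBEq α]
    [Primcodable β] :
    Primrec₂ fun (l : List (α × β)) (a : α) => l.lookup a := by
  refine (Primrec.list_foldr (h := fun (p : List (α × β) × α) (q : (α × β) × Option β) =>
    if p.2 = q.1.1 then some q.1.2 else q.2) Primrec.fst (Primrec.const none) ?_).of_eq fun p =>
      (lookup_eq_foldr _ _).symm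
  exact Primrec.ite (Primrec.eq.comp (Primrec.snd.comp Primrec.fst)
      (Primrec.fst.comp (Primrec.fst.comp Primrec.snd)))
    (Primrec.option_some.comp (Primrec.snd.comp (Primrec.fst.comp Primrec.snd)))
    (Primrec.snd.comp Primrec.snd)

/-- Configurations as a state, the cells to the left of the head, and the other cells. -/
abbrev ListCfg := ℕ × List ℕ × List ℕ

def ListCfg.toCfg (c : ListCfg) : TM0.Cfg ℕ ℕ :=
  ⟨c.1, Tape.mk' (ListBlank.mk c.2.1) (ListBlank.mk c.2.2)⟩

/-- An exhausted list continues with blanks: `headI` of the empty list is `0`, the blank. -/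
def ListCfg.act (c : ListCfg) (e : ℕ × (Bool ⊕ ℕ)) : ListCfg :=
  Sum.casesOn (motive := fun _ => ListCfg) e.2
    (fun b => cond b (e.1, c.2.2.headI :: c.2.1, c.2.2.tail)
      (e.1, c.2.1.tail, c.2.1.headI :: c.2.2.headI :: c.2.2.tail))
    (fun b => (e.1, c.2.1, b :: c.2.2.tail))

def TMachine.entry (M : TMachine) (c : ListCfg) : Option (ℕ × (Bool ⊕ ℕ)) :=
  M.table.lookup (c.1, c.2.2.headI)

/-- One step; halting configurations are kept. -/
def TMachine.next (M : TMachine) (c : ListCfg) : ListCfg :=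
  ((M.entry c).map c.act).getD c

theorem TMachine.step_toCfg (M : TMachine) (c : ListCfg) :
    TM0.step M.machine c.toCfg = (M.entry c).map fun e => (c.act e).toCfg := by
  obtain ⟨q, L, R⟩ := c
  simp only [TM0.step, ListCfg.toCfg, Tape.mk', ListBlank.head_mk, TMachine.machine,
    TMachine.entry, Option.map_map]
  congr 1
  funext e
  obtain ⟨q', (b | b)⟩ := e
  · cases b <;>
      simp [actionOf, ListCfg.act, Tape.move, ListBlank.cons_mk, ListBlank.head_mk,
        ListBlank.tail_mk]
  · simp [actionOf, ListCfg.act, Tape.write]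

def TMachine.HaltsIn (M : TMachine) (n : ℕ) (c : ListCfg) : Prop :=
  M.entry (M.next^[n] c) = none ∧ ∃ q ∈ M.accept, q = (M.next^[n] c).1

theorem TMachine.exists_haltsIn_iff (M : TMachine) (c : ListCfg) :
    (∃ n, M.HaltsIn n c) ↔ ∃ d, TM0.Reaches M.machine c.toCfg d ∧
      TM0.step M.machine d = none ∧ d.q ∈ M.accept := by
  constructor
  · rintro ⟨n, h1, q, h2, rfl⟩
    refine ⟨(M.next^[n] c).toCfg, ?_, by rw [M.step_toCfg, h1]; rfl, h2⟩
    clear h1 h2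
    induction n generalizing c with
    | zero => exact Relation.ReflTransGen.refl
    | succ n ih =>
      rw [Function.iterate_succ_apply]
      cases h : M.entry c with
      | none =>
        have hc : M.next c = c := by simp [TMachine.next, h]
        rw [hc]
        exact ih c
      | some e =>
        have hc : M.next c = c.act e := by simp [TMachine.next, h]
        refine Relation.ReflTransGen.head ?_ (ih _)
        rw [M.step_toCfg, h, hc]
        rfl
  · rintro ⟨d, h1, h2, h3⟩
    generalize hc : c.toCfg = c' at h1
    induction h1 using Relation.ReflTransGen.head_induction_on generalizing c with
    | refl =>
      subst hc
      rw [M.step_toCfg, Option.map_eq_none_iff] at h2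
      exact ⟨0, h2, _, h3, rfl⟩
    | head h _ ih =>
      subst hc
      rw [M.step_toCfg, Option.mem_def, Option.map_eq_some_iff] at h
      obtain ⟨e, he, rfl⟩ := h
      obtain ⟨n, hn⟩ := ih _ rfl
      refine ⟨n + 1, ?_⟩
      have hc : M.next c = c.act e := by simp [TMachine.next, he]
      rw [TMachine.HaltsIn, Function.iterate_succ_apply, hc]
      exact hn

theorem primrec_table : Primrec TMachine.table :=
  Primrec.fst.comp (Primrec.of_equiv (e := TMachine.equivProd))

theorem primrec_accept : Primrec TMachine.accept :=
  Primrec.snd.comp (Primrec.of_equiv (e := TMachine.equivProd))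

theorem primrec₂_entry : Primrec₂ TMachine.entry := by
  have h : Primrec fun p : TMachine × ListCfg => (p.2.1, p.2.2.2.headI) :=
    (Primrec.fst.comp Primrec.snd).pair
      (Primrec.list_headI.comp (Primrec.snd.comp (Primrec.snd.comp Primrec.snd)))
  exact primrec₂_lookup.comp (primrec_table.comp Primrec.fst) h

theorem primrec₂_act : Primrec₂ ListCfg.act := by
  have hL : Primrec fun p : ListCfg × ℕ × (Bool ⊕ ℕ) => p.1.2.1 :=
    Primrec.fst.comp (Primrec.snd.comp Primrec.fst)
  have hR : Primrec fun p : ListCfg × ℕ × (Bool ⊕ ℕ) => p.1.2.2 :=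
    Primrec.snd.comp (Primrec.snd.comp Primrec.fst)
  have hq : Primrec fun p : ListCfg × ℕ × (Bool ⊕ ℕ) => p.2.1 := Primrec.fst.comp Primrec.snd
  have hh : Primrec fun p : ListCfg × ℕ × (Bool ⊕ ℕ) => p.1.2.2.headI := Primrec.list_headI.comp hR
  have ht : Primrec fun p : ListCfg × ℕ × (Bool ⊕ ℕ) => p.1.2.2.tail := Primrec.list_tail.comp hR
  have h1 : Primrec fun p : ListCfg × ℕ × (Bool ⊕ ℕ) =>
      ((p.2.1, p.1.2.2.headI :: p.1.2.1, p.1.2.2.tail) : ListCfg) :=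
    hq.pair ((Primrec.list_cons.comp hh hL).pair ht)
  have h2 : Primrec fun p : ListCfg × ℕ × (Bool ⊕ ℕ) =>
      ((p.2.1, p.1.2.1.tail, p.1.2.1.headI :: p.1.2.2.headI :: p.1.2.2.tail) : ListCfg) :=
    hq.pair ((Primrec.list_tail.comp hL).pair (Primrec.list_cons.comp (Primrec.list_headI.comp hL)
      (Primrec.list_cons.comp hh ht)))
  exact Primrec.sumCasesOn (Primrec.snd.comp Primrec.snd)
    (Primrec.cond Primrec.snd (h1.comp Primrec.fst) (h2.comp Primrec.fst)).to₂
    ((hq.comp Primrec.fst).pair ((hL.comp Primrec.fst).pair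
      (Primrec.list_cons.comp Primrec.snd (ht.comp Primrec.fst)))).to₂

theorem primrec₂_next : Primrec₂ TMachine.next :=
  Primrec.option_getD.comp
    (Primrec.option_map primrec₂_entry
      (primrec₂_act.comp (Primrec.snd.comp Primrec.fst) Primrec.snd))
    Primrec.snd

theorem primrecPred_haltsIn {α : Type} [Primcodable α] {M : α → TMachine} {n : α → ℕ}
    {c : α → ListCfg} (hM : Primrec M) (hn : Primrec n) (hc : Primrec c) :
    PrimrecPred fun a => (M a).HaltsIn (n a) (c a) := by
  have h : Primrec fun a => (M a).next^[n a] (c a) :=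
    Primrec.nat_iterate hn hc (primrec₂_next.comp (hM.comp Primrec.fst) Primrec.snd)
  have h1 : PrimrecPred fun a => (M a).entry ((M a).next^[n a] (c a)) = none :=
    Primrec.eq.comp (primrec₂_entry.comp hM h) (Primrec.const none)
  have h2 : PrimrecPred fun a => ∃ q ∈ (M a).accept, q = ((M a).next^[n a] (c a)).1 :=
    (PrimrecRel.exists_mem_list Primrec.eq).comp (primrec_accept.comp hM) (Primrec.fst.comp h)
  exact h1.and h2

theorem primrec_wordVal : Primrec fun p : ℕ × List ℕ => wordVal p.1 0 p.2 :=
  Primrec.list_foldl (h := fun (p : ℕ × List ℕ) (q : ℕ × ℕ) => p.1 * q.1 + q.2)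
    Primrec.snd (Primrec.const 0)
    (Primrec.nat_add.comp (Primrec.nat_mul.comp (Primrec.fst.comp Primrec.fst)
      (Primrec.fst.comp Primrec.snd)) (Primrec.snd.comp Primrec.snd)).to₂

theorem exists_inputDigits_eq {k : ℕ} {u : List ℕ} (hu : ∀ a ∈ u, 0 < a ∧ a < k + 1) :
    ∃ w : List (Fin k), inputDigits w = u := by
  induction u with
  | nil => exact ⟨[], rfl⟩
  | cons a u ih =>
    obtain ⟨w, rfl⟩ := ih fun a h => hu a (List.mem_cons_of_mem _ h)
    have := hu a List.mem_cons_self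
    refine ⟨⟨a - 1, by omega⟩ :: w, ?_⟩
    have h : a - 1 + 1 = a := by omega
    simp [inputDigits, h]

theorem inputDigits_pos_lt {k : ℕ} (w : List (Fin k)) :
    ∀ a ∈ inputDigits w, 0 < a ∧ a < k + 1 := by
  intro a ha
  obtain ⟨i, -, rfl⟩ := List.mem_map.1 ha
  exact ⟨Nat.succ_pos _, Nat.succ_lt_succ i.isLt⟩

theorem inputDigits_wordVal_injective {k : ℕ} {w w' : List (Fin k)}
    (h : wordVal (k + 1) 0 (inputDigits w) = wordVal (k + 1) 0 (inputDigits w')) : w = w' := by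
  have := wordVal_injective (inputDigits_pos_lt w) (inputDigits_pos_lt w') h
  refine (List.map_injective_iff (f := fun i : Fin k => (i : ℕ) + 1)).2 (fun i j hij => ?_) this
  exact Fin.ext (Nat.succ_injective hij)

theorem mem_language_iff {k : ℕ} {M : TMachine} {w : List (Fin k)} :
    w ∈ M.language k ↔ ∃ d, TM0.Reaches M.machine (ListCfg.toCfg (0, [], inputDigits w)) d ∧
      TM0.step M.machine d = none ∧ d.q ∈ M.accept := by
  rfl

/-- The words in the language of a machine, coded as numbers, are enumerable uniformly in the
machine. -/
theorem rePred_language : REPred fun p : (ℕ × TMachine) × ℕ =>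
    ∃ w ∈ p.1.2.language p.1.1, p.2 = wordVal (p.1.1 + 1) 0 (inputDigits w) := by
  have hk : Primrec fun x : ((ℕ × TMachine) × ℕ) × List ℕ × ℕ => x.1.1.1 :=
    Primrec.fst.comp (Primrec.fst.comp Primrec.fst)
  have hM : Primrec fun x : ((ℕ × TMachine) × ℕ) × List ℕ × ℕ => x.1.1.2 :=
    Primrec.snd.comp (Primrec.fst.comp Primrec.fst)
  have hu : Primrec fun x : ((ℕ × TMachine) × ℕ) × List ℕ × ℕ => x.2.1 :=
    Primrec.fst.comp Primrec.snd
  have hk1 : Primrec fun x : ((ℕ × TMachine) × ℕ) × List ℕ × ℕ => x.1.1.1 + 1 :=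
    Primrec.succ.comp hk
  have h1 : PrimrecPred fun x : ((ℕ × TMachine) × ℕ) × List ℕ × ℕ =>
      x.1.2 = wordVal (x.1.1.1 + 1) 0 x.2.1 :=
    Primrec.eq.comp (Primrec.snd.comp Primrec.fst) (primrec_wordVal.comp (hk1.pair hu))
  have hrel : PrimrecRel fun a b : ℕ => 0 < a ∧ a < b :=
    (Primrec.nat_lt.comp (Primrec.const 0) Primrec.fst).and
      (Primrec.nat_lt.comp Primrec.fst Primrec.snd)
  have h2 : PrimrecPred fun x : ((ℕ × TMachine) × ℕ) × List ℕ × ℕ =>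
      ∀ a ∈ x.2.1, 0 < a ∧ a < x.1.1.1 + 1 :=
    (PrimrecRel.forall_mem_list hrel).comp hu hk1
  have h3 : PrimrecPred fun x : ((ℕ × TMachine) × ℕ) × List ℕ × ℕ =>
      x.1.1.2.HaltsIn x.2.2 (0, [], x.2.1) :=
    primrecPred_haltsIn hM (Primrec.snd.comp Primrec.snd)
      ((Primrec.const 0).pair ((Primrec.const []).pair hu))
  -- The search runs over pairs of a list of digits and a number of steps, and every candidate is
  -- checked primitive recursively.
  refine (rePred_exists (p := fun (a : (ℕ × TMachine) × ℕ) (b : List ℕ × ℕ) =>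
    a.2 = wordVal (a.1.1 + 1) 0 b.1 ∧ (∀ x ∈ b.1, 0 < x ∧ x < a.1.1 + 1) ∧
      a.1.2.HaltsIn b.2 (0, [], b.1)) (h1.and (h2.and h3))).of_eq ?_
  rintro ⟨⟨k, M⟩, N⟩
  constructor
  · rintro ⟨⟨u, n⟩, h1, h2, h3⟩
    obtain ⟨w, rfl⟩ := exists_inputDigits_eq h2
    exact ⟨w, mem_language_iff.2 ((M.exists_haltsIn_iff _).1 ⟨n, h3⟩), h1⟩
  · rintro ⟨w, hw, h1⟩
    obtain ⟨n, hn⟩ := (M.exists_haltsIn_iff (0, [], inputDigits w)).2 (mem_language_iff.1 hw)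
    exact ⟨(inputDigits w, n), h1, inputDigits_pos_lt w, hn⟩

/-- Lets the exponent `e` carry the code of an arbitrary object, so that one queue machine serves
all Turing machines. -/
theorem rePred_decode {α : Type} [Primcodable α] {p : α × ℕ → Prop} (hp : REPred p) :
    REPred fun x : ℕ × ℕ => ∃ a ∈ (Encodable.decode x.1 : Option α), p (a, x.2) := by
  have h : Partrec fun x : ℕ × ℕ =>
      (Part.ofOption (Encodable.decode x.1 : Option α)).bind fun a =>
        Part.assert (p (a, x.2)) fun _ => Part.some () :=
    (Computable.ofOption (Computable.decode.comp Computable.fst)).bind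
      (Partrec.comp hp (Computable.snd.pair (Computable.snd.comp Computable.fst))).to₂
  refine h.dom_re.of_eq fun x => ?_
  cases hd : (Encodable.decode x.1 : Option α) with
  | none => simp
  | some a => simp [Part.assert]

end TuringMachines

end APA

namespace APA

/-! ### Reachable configurations along unary paths -/

section Reach

variable {Q X : Type} (ts : List (Q × Q)) (step : Q × Q → X → X)

open Classical in
/-- The configurations reached by one transition. -/
noncomputable def reachNext (l : List (Q × X)) : List (Q × X) :=
  l.flatMap fun y => ts.filterMap fun t => if y.1 = t.1 then some (t.2, step t y.2) else none

theorem mem_reachNext {l : List (Q × X)} {z : Q × X} :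
    z ∈ reachNext ts step l ↔ ∃ x q, (q, x) ∈ l ∧ (q, z.1) ∈ ts ∧ step (q, z.1) x = z.2 := by
  obtain ⟨r, w⟩ := z
  simp only [reachNext, List.mem_flatMap, List.mem_filterMap, Prod.exists,
    Option.ite_none_right_eq_some,
    Option.some.injEq, Prod.mk.injEq]
  constructor
  · rintro ⟨q, x, h, _, _, ht, rfl, rfl, rfl⟩
    exact ⟨x, _, h, ht, rfl⟩
  · rintro ⟨x, q, h, ht, rfl⟩
    exact ⟨q, x, h, _, _, ht, rfl, rfl, rfl⟩

/-- `step` is effective for each transition separately; the finite list of transitions is therefore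
treated by induction, not as an input. -/
theorem primrec_reachNext [Primcodable X] [Primcodable Q] [Finite Q]
    (hstep : ∀ t, Primrec (step t)) :
    Primrec (reachNext ts step) := by
  classical
  have h : ∀ l : List (Q × Q), Primrec fun y : Q × X =>
      l.filterMap fun t => if y.1 = t.1 then some (t.2, step t y.2) else none := by
    intro l
    induction l with
    | nil => exact Primrec.const []
    | cons t l ih =>
      refine (Primrec.list_append.comp (Primrec.ite (c := fun y : Q × X => y.1 = t.1)
        (Primrec.eq.comp Primrec.fst (Primrec.const t.1))
        (Primrec.list_cons.comp ((Primrec.const t.2).pair ((hstep t).comp Primrec.snd))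
          (Primrec.const [])) (Primrec.const [])) ih).of_eq fun y => ?_
      by_cases hy : y.1 = t.1 <;> simp [hy]
  exact Primrec.list_flatMap Primrec.id ((h ts).comp Primrec.snd).to₂

end Reach

/-- Paths over a one-letter alphabet are searched effectively, if the maps of the transitions and
the acceptance condition are effective. -/
theorem primrecPred_exists_run {X V : Type} [Primcodable X] (A : FinAutomaton (Fin 1))
    (F : A.Q × Fin 1 × A.Q → V → V) (val : X → V) (step : A.Q × Fin 1 × A.Q → X → X)
    (hstep : ∀ t, Primrec (step t)) (hval : ∀ t x, val (step t x) = F t (val x)) (x₀ : X)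
    {C : Set V} (hC : PrimrecPred fun x => val x ∈ C) :
    PrimrecPred fun n => ∃ π ∈ A.Run, π.foldl (fun y t => F t y) (val x₀) ∈ C ∧ π.length = n := by
  classical
  have := A.finite
  obtain ⟨m, ⟨e⟩⟩ := Finite.exists_equiv_fin A.Q
  let : Primcodable A.Q := Primcodable.ofEquiv _ e
  obtain ⟨ts, hts⟩ : ∃ ts : List (A.Q × A.Q), ∀ t, t ∈ ts ↔ (t.1, 0, t.2) ∈ A.δ := by
    obtain ⟨l, -, hl⟩ := Finite.exists_univ_list (A.Q × A.Q)
    exact ⟨l.filter fun t => (t.1, 0, t.2) ∈ A.δ, fun t => by simp [hl]⟩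
  -- With a single letter, the `n`-th iterate lists exactly the configurations at the ends of paths
  -- of length `n`.
  let next := reachNext ts fun t => step (t.1, 0, t.2)
  have hnext : ∀ n l q w, (q, w) ∈ next^[n] l ↔ ∃ p x π, (p, x) ∈ l ∧ A.IsPath p π q ∧
      π.foldl (fun y t => step t y) x = w ∧ π.length = n := by
    intro n
    induction n with
    | zero =>
      intro l q w
      simp only [Function.iterate_zero, id_eq, List.length_eq_zero_iff]
      constructor
      · exact fun h => ⟨q, w, [], h, rfl, rfl, rfl⟩
      · rintro ⟨p, x, π, h, h1, h2, rfl⟩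
        obtain rfl : p = q := h1
        obtain rfl : x = w := h2
        exact h
    | succ n ih =>
      intro l q w
      rw [Function.iterate_succ_apply, ih]
      constructor
      · rintro ⟨p, x, π, h, h1, h2, h3⟩
        obtain ⟨x', q', h4, h5, h6⟩ := (mem_reachNext _ _).1 h
        refine ⟨q', x', (q', 0, p) :: π, h4, ⟨(hts _).1 h5, rfl, h1⟩, ?_, by simp [h3]⟩
        rw [← h2, List.foldl_cons]
        exact congrArg (fun y => π.foldl _ y) h6
      · rintro ⟨p, x, π, h, h1, h2, h3⟩
        cases π with
        | nil => simp at h3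
        | cons t π =>
          obtain ⟨q', a, q''⟩ := t
          obtain ⟨h4, h5, h6⟩ := h1
          obtain rfl : q' = p := h5
          obtain rfl : a = 0 := Subsingleton.elim _ _
          exact ⟨q'', step (q', 0, q'') x, π,
            (mem_reachNext _ _).2 ⟨x, q', h, (hts _).2 h4, rfl⟩, h6, h2, by simpa using h3⟩
  have hprim : Primrec fun n : ℕ => next^[n] [(A.q₀, x₀)] :=
    Primrec.nat_iterate Primrec.id (Primrec.const _)
      ((primrec_reachNext ts _ fun t => hstep _).comp Primrec.snd).to₂
  have hF : PrimrecPred fun y : A.Q × X => y.1 ∈ A.F :=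
    PrimrecPred.comp (p := fun q => q ∈ A.F) ⟨inferInstance, Primrec.dom_finite _⟩ Primrec.fst
  have hC' : PrimrecPred fun y : A.Q × X => val y.2 ∈ C := hC.comp Primrec.snd
  refine ((hF.and hC').exists_mem_list.comp hprim).of_eq fun n => ?_
  have hfold : ∀ (π : List (A.Q × Fin 1 × A.Q)) x,
      π.foldl (fun y t => F t y) (val x) = val (π.foldl (fun y t => step t y) x) := by
    intro π
    induction π with
    | nil => exact fun x => rfl
    | cons t π ih => exact fun x => by rw [List.foldl_cons, List.foldl_cons, ← ih, hval]
  simp only [hfold]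
  constructor
  · rintro ⟨⟨q, w⟩, h, h1, h2⟩
    obtain ⟨p, x, π, h3, h4, rfl, h5⟩ := (hnext _ _ _ _).1 h
    obtain ⟨rfl, rfl⟩ : p = A.q₀ ∧ x = x₀ := by simpa using h3
    exact ⟨π, ⟨q, h1, h4⟩, h2, h5⟩
  · rintro ⟨π, ⟨q, h1, h2⟩, h3, h4⟩
    exact ⟨(q, _), (hnext _ _ _ _).2 ⟨_, _, π, List.mem_singleton_self _, h2, rfl, h4⟩, h1, h3⟩

theorem mem_language_replicate {K : Type} [CommSemiring K] [LinearOrder K]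
    (P : AffineParikhAutomaton K (Fin 1)) (n : ℕ) : List.replicate n 0 ∈ P.language ↔
      ∃ π ∈ P.A.Run, π.foldl (fun y t => (P.U t).apply y) 0 ∈ P.C ∧ π.length = n := by
  refine exists_congr fun π => and_congr_right fun _ => and_congr_right fun _ => ?_
  rw [List.eq_replicate_iff, FinAutomaton.label, List.length_map]
  exact and_iff_left fun _ _ => Subsingleton.elim _ _

/-! ### Effective sets of vectors of natural numbers -/

theorem primrec_pi {X Y : Type} [Primcodable X] [Primcodable Y] {d : ℕ} {f : X → Fin d → Y}
    (h : ∀ i, Primrec fun x => f x i) : Primrec f :=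
  Primrec.fin_curry.2 (Primrec.fin_curry₁.2 h).swap

theorem primrec_pi_apply {Y : Type} [Primcodable Y] {d : ℕ} (i : Fin d) :
    Primrec fun f : Fin d → Y => f i :=
  Primrec.fin_app.comp Primrec.id (Primrec.const i)

theorem primrec_sum {X ι : Type} [Primcodable X] [Fintype ι] {f : X → ι → ℕ}
    (h : ∀ i, Primrec fun x => f x i) : Primrec fun x => ∑ i, f x i := by
  classical
  suffices ∀ s : Finset ι, Primrec fun x => ∑ i ∈ s, f x i from this _
  intro s
  induction s using Finset.induction_on with
  | empty => exact Primrec.const 0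
  | insert i s hi ih =>
    exact (Primrec.nat_add.comp (h i) ih).of_eq fun x => (Finset.sum_insert hi).symm

/-- Generators are removed one at a time by searching for the multiplicity of `p`. A nonzero `p` has
a coordinate at least `1`, so the multiplicity is at most the sum of the coordinates of `v`; for `p
= 0` the multiplicity `0` suffices. -/
theorem primrecPred_mem_closure {d : ℕ} (t : Finset (Fin d → ℕ)) :
    PrimrecPred fun v => v ∈ AddSubmonoid.closure (t : Set (Fin d → ℕ)) := by
  classical
  induction t using Finset.induction_on with
  | empty =>
    exact (Primrec.eq.comp Primrec.id (Primrec.const (0 : Fin d → ℕ))).of_eq fun v => by simp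
  | insert p t _ ih =>
    have hv : ∀ i, Primrec fun x : ℕ × (Fin d → ℕ) => x.2 i := fun i =>
      (primrec_pi_apply i).comp Primrec.snd
    have hp : ∀ i, Primrec fun x : ℕ × (Fin d → ℕ) => x.1 * p i := fun i =>
      Primrec.nat_mul.comp Primrec.fst (Primrec.const _)
    have h1 : Primrec fun x : ℕ × (Fin d → ℕ) => x.2 - x.1 • p :=
      primrec_pi fun i => Primrec.nat_sub.comp (hv i) (hp i)
    have h2 : Primrec fun x : ℕ × (Fin d → ℕ) => x.1 • p + (x.2 - x.1 • p) :=
      primrec_pi fun i => Primrec.nat_add.comp (hp i) (Primrec.nat_sub.comp (hv i) (hp i))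
    -- Subtraction is truncated; the equation ensures that `n • p ≤ v` holds coordinatewise.
    have h3 : PrimrecRel fun (n : ℕ) (v : Fin d → ℕ) =>
        n • p + (v - n • p) = v ∧ v - n • p ∈ AddSubmonoid.closure (t : Set (Fin d → ℕ)) :=
      (Primrec.eq.comp h2 Primrec.snd).and (ih.comp h1)
    have h4 : Primrec fun v : Fin d → ℕ => ∑ i, v i + 1 :=
      Primrec.succ.comp (primrec_sum primrec_pi_apply)
    refine (h3.exists_mem_list.comp (Primrec.list_range.comp h4) Primrec.id).of_eq fun v => ?_
    rw [Finset.coe_insert, Set.insert_eq, AddSubmonoid.closure_union, AddSubmonoid.mem_sup]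
    simp only [AddSubmonoid.mem_closure_singleton, List.mem_range, id]
    constructor
    · rintro ⟨n, -, h5, h6⟩
      exact ⟨_, ⟨n, rfl⟩, _, h6, h5⟩
    · rintro ⟨_, ⟨n, rfl⟩, w, hw, rfl⟩
      by_cases hp : p = 0
      · exact ⟨0, by omega, by simp, by simpa [hp] using hw⟩
      · obtain ⟨i, hi⟩ := Function.ne_iff.1 hp
        refine ⟨n, Nat.lt_succ_of_le ?_, by simp, by simpa using hw⟩
        calc n ≤ n * p i := Nat.le_mul_of_pos_right _ (Nat.pos_of_ne_zero hi)
          _ ≤ (n • p + w) i := Nat.le_add_right _ _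
          _ ≤ _ := Finset.single_le_sum (f := n • p + w) (fun _ _ => Nat.zero_le _)
            (Finset.mem_univ i)

theorem primrecPred_mem_of_isSemilinearSet {d : ℕ} {s : Set (Fin d → ℕ)}
    (hs : IsSemilinearSet s) : PrimrecPred fun v => v ∈ s := by
  have hlin : ∀ s : Set (Fin d → ℕ), IsLinearSet s → PrimrecPred fun v => v ∈ s := by
    intro s hs
    obtain ⟨a, t, rfl⟩ := isLinearSet_iff.1 hs
    have h1 : Primrec fun v : Fin d → ℕ => v - a :=
      primrec_pi fun i => Primrec.nat_sub.comp (primrec_pi_apply i) (Primrec.const _)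
    have h2 : Primrec fun v : Fin d → ℕ => a + (v - a) :=
      primrec_pi fun i => Primrec.nat_add.comp (Primrec.const (a i))
        (Primrec.nat_sub.comp (primrec_pi_apply i) (Primrec.const _))
    refine ((Primrec.eq.comp h2 Primrec.id).and ((primrecPred_mem_closure t).comp h1)).of_eq
      fun v => ?_
    rw [Set.mem_vadd_set]
    constructor
    · rintro ⟨h3, h4⟩
      exact ⟨_, h4, h3⟩
    · rintro ⟨w, hw, rfl⟩
      exact ⟨by simp, by simpa using hw⟩
  obtain ⟨S, hS, rfl⟩ := isSemilinearSet_iff.1 hs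
  clear hs
  classical
  induction S using Finset.induction_on with
  | empty => exact (Primrec.eq.comp (Primrec.const 0) (Primrec.const 1)).of_eq fun v => by simp
  | insert s S _ ih =>
    refine ((hlin s (hS s (by simp))).or (ih fun s' h => hS s' (by simp [h]))).of_eq fun v => ?_
    simp

end APA

namespace APA

/-! ### Definable sets of vectors of natural numbers -/

open FirstOrder Language

section Definable

variable {K : Type} [CommSemiring K] [LinearOrder K]

/-- Reduces atomic formulas to comparisons of affine forms, over `ℕ` and over `ℚ` alike. -/
theorem term_realize_eq {ι : Type} [Fintype ι] (t : ((ordLang K)[[(Set.univ : Set K)]]).Term ι) :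
    ∃ (k : K) (u : ι → K), ∀ v : ι → K, t.realize v = k + u ⬝ᵥ v := by
  classical
  induction t with
  | var i => exact ⟨0, Pi.single i 1, fun v => by simp⟩
  | @func l f ts ih =>
    choose k u ih using ih
    cases f with
    | inl f =>
      cases f with
      | add =>
        refine ⟨k 0 + k 1, u 0 + u 1, fun v => ?_⟩
        change (ts 0).realize v + (ts 1).realize v = _
        rw [ih, ih, add_dotProduct]
        ring
      | scale e =>
        refine ⟨e * k 0, e • u 0, fun v => ?_⟩
        change e * (ts 0).realize v = _
        rw [ih, smul_dotProduct, mul_add, smul_eq_mul]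
    | inr f =>
      cases l with
      | zero =>
        refine ⟨f, 0, fun v => ?_⟩
        rw [zero_dotProduct, add_zero]
        rfl
      | succ => nomatch f

end Definable

/-- Solution sets of linear equations over `ℕ` are semilinear, and semilinear sets are closed under
Boolean operations and projections. A universal quantifier is the complement of a projection of a
complement. -/
theorem isSemilinearSet_boundedFormula_realize {α : Type} [Finite α] {n : ℕ}
    (φ : ((ordLang ℕ)[[(Set.univ : Set ℕ)]]).BoundedFormula α n) :
    IsSemilinearSet {v : α ⊕ Fin n → ℕ | φ.Realize (v ∘ Sum.inl) (v ∘ Sum.inr)} := by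
  have := Fintype.ofFinite α
  induction φ with simp only [BoundedFormula.Realize]
  | equal t₁ t₂ =>
    obtain ⟨k₁, u₁, ht₁⟩ := term_realize_eq t₁
    obtain ⟨k₂, u₂, ht₂⟩ := term_realize_eq t₂
    convert! Nat.isSemilinearSet_setOfPred_mulVec_eq ![k₁] ![k₂] (.of ![u₁]) (.of ![u₂])
    simp [ht₁, ht₂]
  | @rel n l r ts =>
    cases r with
    | inr r => cases r
    | inl r =>
      cases r
      obtain ⟨k₁, u₁, ht₁⟩ := term_realize_eq (ts 0)
      obtain ⟨k₂, u₂, ht₂⟩ := term_realize_eq (ts 1)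
      -- The inequality `x < y` is the projection of the equation `x + 1 + a = y` with a slack
      -- variable `a`.
      have h := (Nat.isSemilinearSet_setOfPred_mulVec_eq ![k₁ + 1] ![k₂]
        (.of ![Sum.elim u₁ (fun _ : Fin 1 => 1)]) (.of ![Sum.elim u₂ (fun _ : Fin 1 => 0)])).proj
      convert! h using 1
      ext v
      change (ts 0).realize (Sum.elim (v ∘ Sum.inl) (v ∘ Sum.inr)) <
        (ts 1).realize (Sum.elim (v ∘ Sum.inl) (v ∘ Sum.inr)) ↔ _
      rw [ht₁, ht₂, Sum.elim_comp_inl_inr]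
      simp only [Set.mem_ofPred_eq, funext_iff, Fin.forall_fin_one, Fin.exists_fin_succ_pi,
        dotProduct, Fintype.sum_sum_type]
      simp [dotProduct]
      rw [← Nat.succ_le_iff, le_iff_exists_add]
      refine exists_congr fun a => ?_
      rw [eq_comm]
      omega
  | falsum => exact .empty
  | imp _ _ ih₁ ih₂ =>
    convert! (ih₂.compl.inter ih₁).compl using 1
    simp [Set.ofPred_inter_eq_sep, imp_iff_not_or, Set.compl_ofPred]
  | @all n φ ih =>
    let e := (Equiv.sumAssoc α (Fin n) (Fin 1)).trans (Equiv.sumCongr (.refl α) finSumFinEquiv)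
    rw [← isSemilinearSet_image_iff (LinearEquiv.funCongrLeft ℕ ℕ e)] at ih
    convert! ih.compl.proj.compl using 1
    simp_rw [Set.compl_ofPred, not_exists, Fin.forall_fin_succ_pi, Fin.forall_fin_zero_pi,
      Set.mem_compl_iff, Set.mem_image, not_not, ← LinearEquiv.eq_symm_apply,
      LinearEquiv.funCongrLeft_symm, exists_eq_right, Set.mem_ofPred,
      LinearEquiv.funCongrLeft_apply, LinearMap.funLeft, LinearMap.coe_mk, AddHom.coe_mk]
    congr! 4
    ext i
    cases i using Fin.lastCases <;> simp [e]

theorem IsDefinable.isSemilinearSet {d : ℕ} {C : Set (Fin d → ℕ)} (h : IsDefinable ℕ C) :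
    IsSemilinearSet C := by
  obtain ⟨φ, rfl⟩ := h
  let e := Equiv.sumEmpty (Fin d) (Fin 0)
  convert! (isSemilinearSet_boundedFormula_realize φ).image (LinearMap.funLeft ℕ ℕ e.symm)
  ext x
  simp only [Set.mem_ofPred_eq, Set.mem_image]
  rw [(e.arrowCongr (.refl ℕ)).exists_congr_left]
  simp [Formula.Realize, Unique.eq_default, Function.comp_def, LinearMap.funLeft, e]

theorem IsDetAPALanguage.isAPALanguage {K : Type} [CommSemiring K] [LinearOrder K] {σ : Type}
    {L : Set (List σ)} (h : IsDetAPALanguage K L) : IsAPALanguage K L :=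
  h.imp fun _ hP => hP.2

/-- The automaton is fixed, so a semilinear presentation of its constraint may be built into the
algorithm and need not be computed. -/
theorem computablePred_replicate_mem_nat {L : Set (List (Fin 1))} (hL : IsAPALanguage ℕ L) :
    ComputablePred fun n => List.replicate n 0 ∈ L := by
  obtain ⟨P, rfl⟩ := hL
  refine ((primrecPred_exists_run P.A (fun t => (P.U t).apply) id (fun t => (P.U t).apply)
    (fun t => primrec_pi fun i => ?_) (fun t x => rfl) 0
    (primrecPred_mem_of_isSemilinearSet P.definable.isSemilinearSet)).of_eq
      fun n => (mem_language_replicate P n).symm).computablePred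
  exact Primrec.nat_add.comp (primrec_sum fun j =>
    Primrec.nat_mul.comp (Primrec.const _) (primrec_pi_apply j)) (Primrec.const _)

end APA

namespace APA

/-! ### Definable sets of rational vectors -/

open FirstOrder Language

/-- The affine form `x ↦ ℓ.1 + ℓ.2 ⬝ᵥ x`. -/
abbrev AffineForm (ι : Type) := ℚ × (ι → ℚ)

def AffineForm.eval {ι : Type} [Fintype ι] (ℓ : AffineForm ι) (x : ι → ℚ) : ℚ := ℓ.1 + ℓ.2 ⬝ᵥ x

/-- The forms in `S` are positive at the same of the points `x` and `y`. -/
def SameSigns {ι : Type} [Fintype ι] (S : Set (AffineForm ι)) (x y : ι → ℚ) : Prop :=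
  ∀ ℓ ∈ S, (0 < ℓ.eval x ↔ 0 < ℓ.eval y)

theorem SameSigns.symm {ι : Type} [Fintype ι] {S : Set (AffineForm ι)} {x y : ι → ℚ}
    (h : SameSigns S x y) : SameSigns S y x := fun ℓ hℓ => (h ℓ hℓ).symm

/-- If `a` is some `r i`, take `r' i`. Otherwise density, and the absence of endpoints, give a point
between the images of the values below and above `a`. -/
theorem exists_same_position {I : Type} {S : Set I} (hS : S.Finite) {r r' : I → ℚ}
    (h : ∀ i ∈ S, ∀ j ∈ S, r i < r j → r' i < r' j)
    (h' : ∀ i ∈ S, ∀ j ∈ S, r' i < r' j → r i < r j) (a : ℚ) :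
    ∃ b, ∀ i ∈ S, (a < r i ↔ b < r' i) ∧ (r i < a ↔ r' i < b) := by
  classical
  by_cases ha : ∃ i ∈ S, r i = a
  · obtain ⟨i, hi, rfl⟩ := ha
    exact ⟨r' i, fun j hj => ⟨⟨h i hi j hj, h' i hi j hj⟩, ⟨h j hj i hi, h' j hj i hi⟩⟩⟩
  · obtain ⟨b, hb, hb'⟩ := Order.exists_between_finsets
      ((hS.toFinset.filter fun i => r i < a).image r')
      ((hS.toFinset.filter fun i => a < r i).image r') (by
        intro x hx y hy
        simp only [Finset.mem_image, Finset.mem_filter, Set.Finite.mem_toFinset] at hx hy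
        obtain ⟨i, ⟨hi, hi'⟩, rfl⟩ := hx
        obtain ⟨j, ⟨hj, hj'⟩, rfl⟩ := hy
        exact h i hi j hj (hi'.trans hj'))
    refine ⟨b, fun i hi => ?_⟩
    rcases lt_trichotomy (r i) a with h1 | h1 | h1
    · have h2 : r' i < b := hb _ (Finset.mem_image_of_mem _ (by simp [hi, h1]))
      exact ⟨iff_of_false h1.not_gt h2.not_gt, iff_of_true h1 h2⟩
    · exact absurd ⟨i, hi, h1⟩ ha
    · have h2 : b < r' i := hb' _ (Finset.mem_image_of_mem _ (by simp [hi, h1]))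
      exact ⟨iff_of_true h1 h2, iff_of_false h1.not_gt h2.not_gt⟩

theorem AffineForm.eval_sub_smul {ι : Type} [Fintype ι] (c c' : ℚ) (ℓ ℓ' : AffineForm ι)
    (x : ι → ℚ) : AffineForm.eval (c • ℓ - c' • ℓ') x = c * ℓ.eval x - c' * ℓ'.eval x := by
  simp only [AffineForm.eval, Prod.fst_sub, Prod.snd_sub, Prod.smul_fst, Prod.smul_snd,
    sub_dotProduct, smul_dotProduct, smul_eq_mul]
  ring

/-- Elimination of one variable `a` from the signs of the forms `c i * a + m i`. -/
theorem exists_forms_eliminate {ι I : Type} [Fintype ι] {S : Set I} (hS : S.Finite) (c : I → ℚ)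
    (m : I → AffineForm ι) :
    ∃ T : Set (AffineForm ι), T.Finite ∧ ∀ x y, SameSigns T x y → ∀ a, ∃ b, ∀ i ∈ S,
      (0 < c i * a + (m i).eval x ↔ 0 < c i * b + (m i).eval y) := by
  -- For `c i ≠ 0` the sign depends on the position of `a` relative to the root `-(c i)⁻¹ * m i`,
  -- and the differences fix the order of the roots. The forms `m i` themselves settle the case `c i
  -- = 0`, where the convention `0⁻¹ = 0` merely adds a harmless root `0`.
  refine ⟨m '' S ∪ Set.image2 (fun i j => (c i)⁻¹ • m i - (c j)⁻¹ • m j) S S,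
    (hS.image _).union (hS.image2 _ hS), fun x y h a => ?_⟩
  have hpos : ∀ i ∈ S, ∀ j ∈ S, (-((c i)⁻¹ * (m i).eval x) < -((c j)⁻¹ * (m j).eval x) ↔
      -((c i)⁻¹ * (m i).eval y) < -((c j)⁻¹ * (m j).eval y)) := by
    intro i hi j hj
    have := h _ (Or.inr (Set.mem_image2_of_mem hi hj))
    rw [AffineForm.eval_sub_smul, AffineForm.eval_sub_smul, sub_pos, sub_pos] at this
    rwa [neg_lt_neg_iff, neg_lt_neg_iff]
  obtain ⟨b, hb⟩ := exists_same_position hS (fun i hi j hj => (hpos i hi j hj).1)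
    (fun i hi j hj => (hpos i hi j hj).2) a
  refine ⟨b, fun i hi => ?_⟩
  obtain ⟨h1, h2⟩ := hb i hi
  have hroot : ∀ z t : ℚ, c i ≠ 0 → c i * z + t = c i * (z - -((c i)⁻¹ * t)) := by
    intro z t hc
    field_simp
    ring
  rcases lt_trichotomy (c i) 0 with hc | hc | hc
  · have hneg : ∀ z, 0 < c i * z ↔ z < 0 := fun z => ⟨fun hz => by
      by_contra h3
      exact (mul_nonpos_of_nonpos_of_nonneg hc.le (not_lt.1 h3)).not_gt hz,
      mul_pos_of_neg_of_neg hc⟩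
    rw [hroot _ _ hc.ne, hroot _ _ hc.ne, hneg, hneg, sub_neg, sub_neg]
    exact h1
  · simpa [hc] using h _ (Or.inl (Set.mem_image_of_mem _ hi))
  · rw [hroot _ _ hc.ne', hroot _ _ hc.ne', mul_pos_iff_of_pos_left hc, mul_pos_iff_of_pos_left hc,
      sub_pos, sub_pos]
    exact h2

/-- Quantifier elimination in semantic form: at a quantifier, points with equal signs have matching
extensions, as in a back-and-forth argument. -/
theorem exists_forms_boundedFormula {α : Type} [Fintype α] {n : ℕ}
    (φ : ((ordLang ℚ)[[(Set.univ : Set ℚ)]]).BoundedFormula α n) :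
    ∃ S : Set (AffineForm (α ⊕ Fin n)), S.Finite ∧ ∀ v xs v' xs',
      SameSigns S (Sum.elim v xs) (Sum.elim v' xs') → (φ.Realize v xs ↔ φ.Realize v' xs') := by
  have hsub : ∀ {n} (t₁ t₂ : ((ordLang ℚ)[[(Set.univ : Set ℚ)]]).Term (α ⊕ Fin n)),
      ∃ ℓ : AffineForm (α ⊕ Fin n), ∀ v, t₁.realize v < t₂.realize v ↔ 0 < ℓ.eval v := by
    intro n t₁ t₂
    obtain ⟨k₁, u₁, h₁⟩ := term_realize_eq t₁
    obtain ⟨k₂, u₂, h₂⟩ := term_realize_eq t₂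
    refine ⟨(k₂ - k₁, u₂ - u₁), fun v => ?_⟩
    rw [h₁, h₂, AffineForm.eval, sub_dotProduct, ← sub_pos]
    ring_nf
  induction φ with
  | falsum => exact ⟨∅, Set.finite_empty, fun _ _ _ _ _ => Iff.rfl⟩
  | equal t₁ t₂ =>
    obtain ⟨ℓ₁, h₁⟩ := hsub t₁ t₂
    obtain ⟨ℓ₂, h₂⟩ := hsub t₂ t₁
    refine ⟨{ℓ₁, ℓ₂}, Set.toFinite _, fun v xs v' xs' h => ?_⟩
    simp only [BoundedFormula.Realize, le_antisymm_iff, ← not_lt, h₁, h₂,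
      h ℓ₁ (by simp), h ℓ₂ (by simp)]
  | @rel n l r ts =>
    cases r with
    | inr r => cases r
    | inl r =>
      cases r
      obtain ⟨ℓ, h₁⟩ := hsub (ts 0) (ts 1)
      refine ⟨{ℓ}, Set.toFinite _, fun v xs v' xs' h => ?_⟩
      change (ts 0).realize (Sum.elim v xs) < (ts 1).realize (Sum.elim v xs) ↔
        (ts 0).realize (Sum.elim v' xs') < (ts 1).realize (Sum.elim v' xs')
      rw [h₁, h₁]
      exact h ℓ rfl
  | imp _ _ ih₁ ih₂ =>
    obtain ⟨S₁, hS₁, h₁⟩ := ih₁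
    obtain ⟨S₂, hS₂, h₂⟩ := ih₂
    exact ⟨S₁ ∪ S₂, hS₁.union hS₂, fun v xs v' xs' h => imp_congr
      (h₁ _ _ _ _ fun ℓ hℓ => h ℓ (Or.inl hℓ)) (h₂ _ _ _ _ fun ℓ hℓ => h ℓ (Or.inr hℓ))⟩
  | @all n φ ih =>
    obtain ⟨S, hS, h⟩ := ih
    obtain ⟨T, hT, hTS⟩ := exists_forms_eliminate hS (fun ℓ => ℓ.2 (Sum.inr (Fin.last n)))
      fun ℓ => ((ℓ.1, fun i => ℓ.2 (Sum.map id Fin.castSucc i)) : AffineForm (α ⊕ Fin n))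
    have heval : ∀ (ℓ : AffineForm (α ⊕ Fin (n + 1))) (v : α → ℚ) (xs : Fin n → ℚ) (a : ℚ),
        ℓ.eval (Sum.elim v (Fin.snoc xs a)) = ℓ.2 (Sum.inr (Fin.last n)) * a + AffineForm.eval
          ((ℓ.1, fun i => ℓ.2 (Sum.map id Fin.castSucc i)) : AffineForm (α ⊕ Fin n))
          (Sum.elim v xs) := by
      intro ℓ v xs a
      simp only [AffineForm.eval, dotProduct, Fintype.sum_sum_type, Fin.sum_univ_castSucc,
        Sum.elim_inl, Sum.elim_inr, Fin.snoc_castSucc, Fin.snoc_last, Sum.map_inl, Sum.map_inr, id]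
      ring
    have key : ∀ v xs v' xs', SameSigns T (Sum.elim v xs) (Sum.elim v' xs') →
        φ.all.Realize v' xs' → φ.all.Realize v xs := by
      intro v xs v' xs' hs hall a
      obtain ⟨b, hb⟩ := hTS _ _ hs a
      refine (h v _ v' (Fin.snoc xs' b) fun ℓ hℓ => ?_).2 (hall b)
      rw [heval, heval]
      exact hb ℓ hℓ
    exact ⟨T, hT, fun v xs v' xs' hs => ⟨key _ _ _ _ hs.symm, key _ _ _ _ hs⟩⟩

theorem IsDefinable.exists_forms {d : ℕ} {C : Set (Fin d → ℚ)} (h : IsDefinable ℚ C) :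
    ∃ S : Set (AffineForm (Fin d)), S.Finite ∧ ∀ x y, SameSigns S x y → (x ∈ C ↔ y ∈ C) := by
  obtain ⟨φ, rfl⟩ := h
  obtain ⟨S, hS, h⟩ := exists_forms_boundedFormula φ
  refine ⟨(fun ℓ : AffineForm (Fin d ⊕ Fin 0) => (ℓ.1, ℓ.2 ∘ Sum.inl)) '' S, hS.image _,
    fun x y hxy => h x _ y _ fun ℓ hℓ => ?_⟩
  simpa [AffineForm.eval, dotProduct] using hxy _ (Set.mem_image_of_mem _ hℓ)

/-- Such a predicate is a finite Boolean combination of those in `S`. The induction splits off one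
`p` and treats its two truth values separately. -/
theorem primrecPred_of_determined {X : Type} [Primcodable X] {S : Set (X → Prop)} (hS : S.Finite)
    (hp : ∀ p ∈ S, PrimrecPred p) {P : X → Prop}
    (hP : ∀ x y, (∀ p ∈ S, (p x ↔ p y)) → (P x ↔ P y)) : PrimrecPred P := by
  induction S, hS using Set.Finite.induction_on generalizing P with
  | empty =>
    classical
    by_cases h : ∃ x, P x
    · obtain ⟨x, hx⟩ := h
      exact (Primrec.eq.comp (Primrec.const 0) (Primrec.const 0)).of_eq fun y =>
        iff_of_true rfl ((hP x y (by simp)).1 hx)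
    · exact (Primrec.eq.comp (Primrec.const 0) (Primrec.const 1)).of_eq fun y =>
        iff_of_false zero_ne_one fun hy => h ⟨y, hy⟩
  | @insert p S _ _ ih =>
    have hdet : ∀ Y : Set X, PrimrecPred fun x => ∃ y ∈ Y, P y ∧ ∀ q ∈ S, (q x ↔ q y) := by
      intro Y
      refine ih (fun q hq => hp q (Or.inr hq)) fun x x' hx => ?_
      refine exists_congr fun y => and_congr_right fun _ => and_congr_right fun _ =>
        forall₂_congr fun q hq => ?_
      rw [hx q hq]
    have hpp := hp p (Or.inl rfl)
    refine ((hpp.and (hdet {y | p y})).or (hpp.not.and (hdet {y | ¬ p y}))).of_eq fun x => ?_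
    constructor
    · rintro (⟨h, y, hy, h1, h2⟩ | ⟨h, y, hy, h1, h2⟩)
      · refine (hP x y ?_).2 h1
        rintro q (rfl | hq)
        exacts [iff_of_true h hy, h2 q hq]
      · refine (hP x y ?_).2 h1
        rintro q (rfl | hq)
        exacts [iff_of_false h hy, h2 q hq]
    · intro hx
      by_cases h : p x
      · exact Or.inl ⟨h, x, h, hx, fun _ _ => Iff.rfl⟩
      · exact Or.inr ⟨h, x, h, hx, fun _ _ => Iff.rfl⟩

/-! ### Rational vectors as vectors of natural numbers -/

/-- `(a, b, s)` stands for the vector `(a - b) / (s + 1)`. -/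
abbrev RatCode (d : ℕ) := (Fin d → ℕ) × (Fin d → ℕ) × ℕ

def RatCode.value {d : ℕ} (x : RatCode d) (i : Fin d) : ℚ :=
  ((x.1 i : ℚ) - x.2.1 i) / (x.2.2 + 1)

theorem exists_common_denominator {ι : Type} [Fintype ι] (f : ι → ℚ) :
    ∃ D : ℕ, 0 < D ∧ ∃ p n : ι → ℕ, ∀ i, f i * D = p i - n i := by
  refine ⟨∏ i, (f i).den, Finset.prod_pos fun i _ => (f i).den_pos, ?_⟩
  have h : ∀ i, ∃ z : ℤ, f i * (∏ i, (f i).den : ℕ) = z := by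
    intro i
    obtain ⟨k, hk⟩ := Finset.dvd_prod_of_mem (fun i => (f i).den) (Finset.mem_univ i)
    refine ⟨(f i).num * k, ?_⟩
    rw [hk, Nat.cast_mul, ← mul_assoc, Rat.mul_den_eq_num]
    simp
  choose z hz using h
  refine ⟨fun i => (z i).toNat, fun i => (-z i).toNat, fun i => ?_⟩
  rw [hz]
  exact_mod_cast (Int.toNat_sub_toNat_neg (z i)).symm

/-- Affine forms are computed on codes with natural coefficients and a common denominator. -/
theorem exists_primrec_forms {d e : ℕ} (f : Fin e → AffineForm (Fin d)) :
    ∃ (D : ℕ) (p n : RatCode d → Fin e → ℕ), 0 < D ∧ Primrec p ∧ Primrec n ∧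
      ∀ x i, (f i).eval x.value * (D * (x.2.2 + 1)) = p x i - n x i := by
  obtain ⟨D, hD, P, N, h⟩ := exists_common_denominator
    (Sum.elim (fun i => (f i).1) fun q : Fin e × Fin d => (f q.1).2 q.2)
  -- The product `(P - N) * (a - b)` has positive part `P * a + N * b`; exchanging `P` and `N` gives
  -- the negative part.
  have hlin : ∀ P N : Fin e ⊕ Fin e × Fin d → ℕ, Primrec fun (x : RatCode d) (i : Fin e) =>
      ∑ j, (P (.inr (i, j)) * x.1 j + N (.inr (i, j)) * x.2.1 j) + P (.inl i) * (x.2.2 + 1) := by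
    intro P N
    refine primrec_pi fun i => Primrec.nat_add.comp (primrec_sum fun j => Primrec.nat_add.comp
      (Primrec.nat_mul.comp (Primrec.const _) ((primrec_pi_apply j).comp Primrec.fst))
      (Primrec.nat_mul.comp (Primrec.const _)
        ((primrec_pi_apply j).comp (Primrec.fst.comp Primrec.snd))))
      (Primrec.nat_mul.comp (Primrec.const _)
        (Primrec.succ.comp (Primrec.snd.comp Primrec.snd)))
  refine ⟨D, _, _, hD, hlin P N, hlin N P, fun x i => ?_⟩
  have h1 := h (.inl i)
  have h2 : ∀ j, (f i).2 j * D = P (.inr (i, j)) - N (.inr (i, j)) := fun j => h (.inr (i, j))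
  have hs : (x.2.2 : ℚ) + 1 ≠ 0 := by positivity
  simp only [Sum.elim_inl] at h1
  push_cast
  have h3 : ((f i).2 ⬝ᵥ x.value) * (D * (x.2.2 + 1)) =
      ∑ j, ((P (.inr (i, j)) : ℚ) - N (.inr (i, j))) * (x.1 j - x.2.1 j) := by
    rw [dotProduct, Finset.sum_mul]
    refine Finset.sum_congr rfl fun j _ => ?_
    rw [← h2, RatCode.value]
    field_simp
  rw [AffineForm.eval, add_mul, h3, ← mul_assoc, h1, add_sub_add_comm, ← Finset.sum_sub_distrib,
    add_comm]
  congr 1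
  · exact Finset.sum_congr rfl fun j _ => by ring
  · ring

theorem primrecPred_value_mem {d : ℕ} {C : Set (Fin d → ℚ)} (hC : IsDefinable ℚ C) :
    PrimrecPred fun x : RatCode d => x.value ∈ C := by
  obtain ⟨S, hS, h⟩ := hC.exists_forms
  refine primrecPred_of_determined (hS.image fun ℓ (x : RatCode d) => 0 < ℓ.eval x.value) ?_
    fun x y hxy => h _ _ fun ℓ hℓ => hxy _ (Set.mem_image_of_mem _ hℓ)
  rintro _ ⟨ℓ, -, rfl⟩
  obtain ⟨D, p, n, hD, hp, hn, hpn⟩ := exists_primrec_forms fun _ : Fin 1 => ℓ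
  refine (Primrec.nat_lt.comp ((primrec_pi_apply 0).comp hn)
    ((primrec_pi_apply 0).comp hp)).of_eq fun x => ?_
  have hpos : (0 : ℚ) < D * (x.2.2 + 1) := by positivity
  change _ ↔ 0 < ℓ.eval x.value
  rw [← mul_pos_iff_of_pos_right hpos, hpn x 0, sub_pos, Nat.cast_lt]

theorem exists_primrec_step {d : ℕ} (f : Affine ℚ d) :
    ∃ step : RatCode d → RatCode d, Primrec step ∧ ∀ x, (step x).value = f.apply x.value := by
  obtain ⟨D, p, n, hD, hp, hn, hpn⟩ := exists_primrec_forms fun i => (f.v i, f.M i)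
  -- The new denominator is `D * (s + 1)`; a code stores it diminished by one.
  refine ⟨fun x => (p x, n x, D * (x.2.2 + 1) - 1), hp.pair (hn.pair (Primrec.nat_sub.comp
    (Primrec.nat_mul.comp (Primrec.const D) (Primrec.succ.comp (Primrec.snd.comp Primrec.snd)))
    (Primrec.const 1))), fun x => ?_⟩
  funext i
  have hpos : 1 ≤ D * (x.2.2 + 1) := Nat.mul_pos hD (Nat.succ_pos _)
  have hpos' : (0 : ℚ) < D * (x.2.2 + 1) := by positivity
  rw [RatCode.value, Nat.cast_sub hpos, ← hpn x i]
  push_cast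
  rw [sub_add_cancel, mul_div_cancel_right₀ _ hpos'.ne', AffineForm.eval, add_comm]
  rfl

theorem computablePred_replicate_mem_rat {L : Set (List (Fin 1))} (hL : IsAPALanguage ℚ L) :
    ComputablePred fun n => List.replicate n 0 ∈ L := by
  obtain ⟨P, rfl⟩ := hL
  choose step hstep hvalue using fun t => exists_primrec_step (P.U t)
  have h0 : RatCode.value ((0, 0, 0) : RatCode P.d) = 0 := by
    funext i
    simp [RatCode.value]
  have h := primrecPred_exists_run P.A (fun t => (P.U t).apply) RatCode.value step hstep hvalue
    (0, 0, 0) (primrecPred_value_mem P.definable)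
  rw [h0] at h
  exact (h.of_eq fun n => (mem_language_replicate P n).symm).computablePred

end APA

namespace APA

/-! ### Undecidability and nonclosure -/

open Encodable

theorem halting_rePred : REPred fun n : ℕ => ((Denumerable.ofNat Nat.Partrec.Code n).eval 0).Dom :=
  rePred_comp (p := fun c : Nat.Partrec.Code => (c.eval 0).Dom)
    (ComputablePred.halting_problem_re 0) (Primrec.ofNat Nat.Partrec.Code).to_comp

theorem not_computablePred_halting :
    ¬ ComputablePred fun n : ℕ => ((Denumerable.ofNat Nat.Partrec.Code n).eval 0).Dom := fun h =>
  ComputablePred.halting_problem 0 <| by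
    obtain ⟨D, hD, h⟩ := ComputablePred.computable_iff.1 h
    refine ComputablePred.computable_iff.2
      ⟨fun c => D (encode c), hD.comp Computable.encode, funext fun c => ?_⟩
    simpa using congrFun h (encode c)

theorem morphImage_eq_empty {σ τ : Type} {h : σ → List τ} {L : Set (List σ)} :
    morphImage h L = ∅ ↔ L = ∅ := Set.image_eq_empty

section Generic

variable {R K : Type} [CommSemiring K] [LinearOrder K] [CharZero K] {ι : ℕ → R}
  {val : R → K}

/-- The halting problem for programs reduces to the languages of deterministic automata. -/
theorem exists_haltingCode [Denumerable R] (hι : Primrec ι) (hval : ∀ n, val (ι n) = (n : K))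
    (k : ℕ) :
    ∃ (m : ℕ) (c : ℕ → Code R) (h : Fin (m + k) → List (Fin k)), Computable c ∧
      ∀ n, ((c n).toAPA val (m + k)).IsDeterministic ∧
        morphImage h ((c n).toAPA val (m + k)).language =
          {_u | ((Denumerable.ofNat Nat.Partrec.Code n).eval 0).Dom} := by
  -- The relation ignores the input value, so the image contains all words or none.
  obtain ⟨B, s, i, f, tiles, h⟩ := exists_queueCode (T := fun e _ =>
    ((Denumerable.ofNat Nat.Partrec.Code e).eval 0).Dom)
    (rePred_comp (p := fun n => ((Denumerable.ofNat Nat.Partrec.Code n).eval 0).Dom) halting_rePred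
      Computable.fst)
  have hc : Primrec fun n : ℕ => queueCode ι B s i f tiles k n :=
    (primrec_queueCode hι B s i f tiles).comp ((Primrec.const k).pair Primrec.id)
  exact ⟨tiles.length, fun n => queueCode ι B s i f tiles k n, _, hc.to_comp,
    fun n => ⟨queueCode_isDeterministic ι val B s i f tiles k n, h ι val hval k n⟩⟩

/-- No input alphabet is needed: with `k = 0` the image is empty exactly when the program does not
halt, and an image is empty only if the language is. -/
theorem not_computable_language_eq_empty [Denumerable R] (hι : Primrec ι)
    (hval : ∀ n, val (ι n) = (n : K)) :
    ¬ ∃ D : ℕ × Code R → Bool, Computable D ∧ ∀ (k : ℕ) (c : Code R),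
      (c.toAPA val k).IsDeterministic → (D (k, c) = true ↔ (c.toAPA val k).language = ∅) := by
  rintro ⟨D, hD, h⟩
  obtain ⟨m, c, g, hc, hm⟩ := exists_haltingCode hι hval 0
  refine not_computablePred_halting (ComputablePred.computable_iff.2
    ⟨fun n => !D (m + 0, c n), Primrec.not.to_comp.comp
      (hD.comp ((Computable.const (m + 0)).pair hc)), funext fun n => propext ?_⟩)
  have h1 := h _ _ (hm n).1
  rw [← morphImage_eq_empty (h := g), (hm n).2] at h1
  by_cases hn : ((Denumerable.ofNat Nat.Partrec.Code n).eval 0).Dom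
  · have : D (m + 0, c n) ≠ true := fun hd => by simpa [hn] using h1.1 hd
    simpa [hn] using this
  · simpa [hn] using h1

/-- With one input letter, a halting program gives the infinite image of all unary words, which
forces an infinite language; otherwise the language is empty. -/
theorem not_computable_language_finite [Denumerable R] (hι : Primrec ι)
    (hval : ∀ n, val (ι n) = (n : K)) :
    ¬ ∃ D : ℕ × Code R → Bool, Computable D ∧ ∀ (k : ℕ) (c : Code R),
      D (k, c) = true ↔ (c.toAPA val k).language.Finite := by
  rintro ⟨D, hD, h⟩
  obtain ⟨m, c, g, hc, hm⟩ := exists_haltingCode hι hval 1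
  refine not_computablePred_halting (ComputablePred.computable_iff.2
    ⟨fun n => !D (m + 1, c n), Primrec.not.to_comp.comp
      (hD.comp ((Computable.const (m + 1)).pair hc)), funext fun n => propext ?_⟩)
  have h1 := h (m + 1) (c n)
  have h2 := (hm n).2
  by_cases hn : ((Denumerable.ofNat Nat.Partrec.Code n).eval 0).Dom
  · have : ¬ ((c n).toAPA val (m + 1)).language.Finite := fun hfin => by
      have h3 := hfin.image fun w => w.flatMap g
      change (morphImage g _).Finite at h3
      rw [h2] at h3
      simp only [hn, Set.ofPred_true] at h3
      exact Set.infinite_univ h3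
    rw [← h1] at this
    simpa [hn] using this
  · simp only [hn, Set.ofPred_false] at h2
    rw [morphImage_eq_empty] at h2
    rw [h2] at h1
    simpa [hn] using h1

/-- The unary words whose length is a halting program form a morphic image of a deterministic
language. Closure would put them into `𝓛`, where `hdec` makes membership decidable. -/
theorem not_closedUnderMorphisms {𝓛 : ∀ n : ℕ, Set (List (Fin n)) → Prop} (ι : ℕ → R)
    (hval : ∀ n, val (ι n) = (n : K))
    (hdet : ∀ k (c : Code R), (c.toAPA val k).IsDeterministic → 𝓛 k (c.toAPA val k).language)
    (hdec : ∀ L : Set (List (Fin 1)), 𝓛 1 L → ComputablePred fun n => List.replicate n 0 ∈ L) :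
    ¬ ClosedUnderMorphisms 𝓛 := by
  intro hclosed
  have hrep : Primrec fun n : ℕ => List.replicate n 1 :=
    (Primrec.list_map Primrec.list_range (Primrec₂.const 1)).of_eq fun n => by
      simp [List.map_const']
  -- For `k = 1` the word of length `n` is read as `n` digits `1` in base `2`.
  have hrel : PrimrecRel fun (N n : ℕ) => N = wordVal 2 0 (List.replicate n 1) :=
    Primrec.eq.comp Primrec.fst
      (primrec_wordVal.comp ((Primrec.const 2).pair (hrep.comp Primrec.snd)))
  have hT : REPred fun p : ℕ × ℕ => ∃ n : ℕ,
      ((Denumerable.ofNat Nat.Partrec.Code n).eval 0).Dom ∧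
        p.2 = wordVal 2 0 (List.replicate n 1) := by
    -- Halting is witnessed by a bound for `evaln`, so the search runs over a program and a bound.
    have h1 : PrimrecPred fun x : (ℕ × ℕ) × ℕ × ℕ =>
        (((Denumerable.ofNat Nat.Partrec.Code x.2.1).evaln x.2.2 0).isSome = true) :=
      Primrec.eq.comp (Primrec.option_isSome.comp (Nat.Partrec.Code.primrec_evaln.comp
        (((Primrec.snd.comp Primrec.snd).pair ((Primrec.ofNat Nat.Partrec.Code).comp
          (Primrec.fst.comp Primrec.snd))).pair (Primrec.const 0)))) (Primrec.const true)
    have h2 : PrimrecPred fun x : (ℕ × ℕ) × ℕ × ℕ =>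
        x.1.2 = wordVal 2 0 (List.replicate x.2.1 1) :=
      hrel.comp (Primrec.snd.comp Primrec.fst) (Primrec.fst.comp Primrec.snd)
    refine (rePred_exists (p := fun (a b : ℕ × ℕ) =>
      ((Denumerable.ofNat Nat.Partrec.Code b.1).evaln b.2 0).isSome = true ∧
        a.2 = wordVal 2 0 (List.replicate b.1 1)) (h1.and h2)).of_eq fun p => ?_
    simp only [Prod.exists, exists_and_right]
    refine exists_congr fun n => and_congr_left fun _ => ?_
    simp only [Part.dom_iff_mem, Nat.Partrec.Code.evaln_complete, Option.isSome_iff_exists,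
      Option.mem_def]
    exact exists_comm
  obtain ⟨B, s, i, f, tiles, h⟩ := exists_queueCode (T := fun _ N => ∃ n : ℕ,
      ((Denumerable.ofNat Nat.Partrec.Code n).eval 0).Dom ∧
        N = wordVal 2 0 (List.replicate n 1)) hT
  have h1 := hclosed _ _ (morphOfCode (eraseMorph tiles.length 1) (tiles.length + 1) 1) _
    (hdet _ _ (queueCode_isDeterministic ι val B s i f tiles 1 0))
  rw [h ι val hval] at h1
  refine not_computablePred_halting ((hdec _ h1).of_eq fun n => ?_)
  have hd : ∀ n, inputDigits (List.replicate n (0 : Fin 1)) = List.replicate n 1 := fun n => by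
    simp [inputDigits]
  constructor
  · rintro ⟨n', hn, he⟩
    rw [← hd n'] at he
    have := congrArg List.length (inputDigits_wordVal_injective he)
    simp only [List.length_replicate] at this
    exact this ▸ hn
  · intro hn
    exact ⟨n, hn, by rw [← hd n]⟩

end Generic

theorem primrec_ratNumeral : Primrec fun n : ℕ => (((n : ℤ), 0) : ℤ × ℕ) :=
  Primrec.encode_iff.1 (Primrec₂.natPair.comp
    (Primrec.nat_mul.comp (Primrec.const 2) Primrec.id) (Primrec.const 0))

end APA

/-! ### The main theorem -/

theorem mainTheorem4 :
    -- every Turing-recognisable language is effectively `h (L₁ ∩ L₂)`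
    (∃ f : ℕ × APA.TMachine →
          ℕ × APA.Code (ℤ × ℕ) × APA.Code (ℤ × ℕ) × List (List ℕ),
      Computable f ∧
      ∀ (k : ℕ) (M : APA.TMachine) (m : ℕ) (c₁ c₂ : APA.Code (ℤ × ℕ)) (H : List (List ℕ)),
        f (k, M) = (m, c₁, c₂, H) →
          (c₁.ratAPA m).IsDeterministic ∧ (c₂.ratAPA m).IsDeterministic ∧
          M.language k =
            APA.morphImage (APA.morphOfCode H m k)
              ((c₁.ratAPA m).language ∩ (c₂.ratAPA m).language)) ∧
    -- no algorithm decides emptiness on the deterministic automata, over `ℕ` or over `ℚ`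
    (¬ ∃ D : ℕ × APA.Code ℕ → Bool, Computable D ∧
      ∀ (k : ℕ) (c : APA.Code ℕ), (c.natAPA k).IsDeterministic →
        (D (k, c) = true ↔ (c.natAPA k).language = ∅)) ∧
    (¬ ∃ D : ℕ × APA.Code (ℤ × ℕ) → Bool, Computable D ∧
      ∀ (k : ℕ) (c : APA.Code (ℤ × ℕ)), (c.ratAPA k).IsDeterministic →
        (D (k, c) = true ↔ (c.ratAPA k).language = ∅)) ∧
    -- nonclosure under morphisms
    (¬ APA.ClosedUnderMorphisms fun n L => APA.IsAPALanguage ℕ (σ := Fin n) L) ∧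
    (¬ APA.ClosedUnderMorphisms fun n L => APA.IsAPALanguage ℚ (σ := Fin n) L) ∧
    (¬ APA.ClosedUnderMorphisms fun n L => APA.IsDetAPALanguage ℕ (σ := Fin n) L) ∧
    (¬ APA.ClosedUnderMorphisms fun n L => APA.IsDetAPALanguage ℚ (σ := Fin n) L) ∧
    -- no algorithm decides finiteness, over `ℕ` or over `ℚ`
    (¬ ∃ D : ℕ × APA.Code ℕ → Bool, Computable D ∧
      ∀ (k : ℕ) (c : APA.Code ℕ), D (k, c) = true ↔ (c.natAPA k).language.Finite) ∧
    (¬ ∃ D : ℕ × APA.Code (ℤ × ℕ) → Bool, Computable D ∧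
      ∀ (k : ℕ) (c : APA.Code (ℤ × ℕ)), D (k, c) = true ↔ (c.ratAPA k).language.Finite) := by
  have hval : ∀ n : ℕ, (fun r : ℤ × ℕ => (r.1 : ℚ) / ((r.2 : ℚ) + 1)) ((n : ℤ), 0) = n :=
    fun n => by simp
  have hid : ∀ n : ℕ, (id (id n) : ℕ) = (n : ℕ) := fun n => rfl
  refine ⟨?_, APA.not_computable_language_eq_empty Primrec.id hid,
    APA.not_computable_language_eq_empty APA.primrec_ratNumeral hval,
    APA.not_closedUnderMorphisms id hid (fun k c _ => ⟨_, rfl⟩)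
      fun L hL => APA.computablePred_replicate_mem_nat hL,
    APA.not_closedUnderMorphisms (val := fun r : ℤ × ℕ => (r.1 : ℚ) / ((r.2 : ℚ) + 1)) _ hval
      (fun k c _ => ⟨_, rfl⟩)
      fun L hL => APA.computablePred_replicate_mem_rat hL,
    APA.not_closedUnderMorphisms id hid (fun k c h => ⟨_, h, rfl⟩)
      fun L hL => APA.computablePred_replicate_mem_nat hL.isAPALanguage,
    APA.not_closedUnderMorphisms (val := fun r : ℤ × ℕ => (r.1 : ℚ) / ((r.2 : ℚ) + 1)) _ hval
      (fun k c h => ⟨_, h, rfl⟩)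
      fun L hL => APA.computablePred_replicate_mem_rat hL.isAPALanguage,
    APA.not_computable_language_finite Primrec.id hid,
    APA.not_computable_language_finite APA.primrec_ratNumeral hval⟩
  -- The number `e` encodes the alphabet size together with the Turing machine, so one set of tiles
  -- works for all inputs of the algorithm.
  obtain ⟨B, s, i, f, tiles, h⟩ := APA.exists_queueCode (T := fun e N =>
    ∃ a ∈ (Encodable.decode e : Option (ℕ × APA.TMachine)), ∃ w ∈ a.2.language a.1,
      N = APA.wordVal (a.1 + 1) 0 (APA.inputDigits w)) (APA.rePred_decode APA.rePred_language)
  have hcode := (APA.primrec_queueCode APA.primrec_ratNumeral B s i f tiles).comp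
    (Primrec.fst.pair (Primrec.encode (α := ℕ × APA.TMachine)))
  -- The same automaton is output twice: a single deterministic language already has the required
  -- image.
  refine ⟨fun p => (tiles.length + p.1, APA.queueCode _ B s i f tiles p.1 (Encodable.encode p),
    APA.queueCode _ B s i f tiles p.1 (Encodable.encode p), APA.eraseMorph tiles.length p.1),
    (Primrec.pair (Primrec.nat_add.comp (Primrec.const _) Primrec.fst) (hcode.pair (hcode.pair
      (APA.primrec₂_eraseMorph.comp (Primrec.const _) Primrec.fst)))).to_comp, ?_⟩
  rintro k M m c₁ c₂ H he
  obtain ⟨rfl, rfl, rfl, rfl⟩ : _ ∧ _ ∧ _ ∧ _ := by simpa only [Prod.mk.injEq] using he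
  refine ⟨APA.queueCode_isDeterministic _ _ B s i f tiles k _,
    APA.queueCode_isDeterministic _ _ B s i f tiles k _, ?_⟩
  rw [Set.inter_self, APA.Code.ratAPA, h _ _ hval]
  ext w
  simp only [Set.mem_ofPred_eq, Encodable.encodek, Option.mem_some_iff, exists_eq_left']
  exact ⟨fun hw => ⟨w, hw, rfl⟩, fun ⟨w', hw', he⟩ =>
    APA.inputDigits_wordVal_injective he ▸ hw'⟩
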